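/- Let $G$ be a finite connected graph with at least one edge, with loops and multiple edges allowed, and let $\ell$ assign to each edge $e$ a length $\ell(e)>0$; identify each edge $e$ with an interval of length $\ell(e)$. Put $L=\sum_e \ell(e)$, and let $\beta=m-n+1$ be the Betti number of $G$, where $m$ is the number of edges and $n$ the number of vertices. A vertex is pendant if its degree is one (a loop contributes two to the degree). For a set $D$ of vertices, consider the problem of finding real-valued functions $f$, continuous on the metric graph $(G,\ell)$, and $\lambda\in\mathbb R$ such that $-f''=\lambda f$ on each edge, $f(v)=0$ at each vertex $v\in D$, and $\sum_{e\sim v} f'(v)=0$ at each vertex $v\notin D$; here the sum is over the edge ends at $v$ (so a loop contributes two terms) and the derivatives are taken at $v$ in the direction away from $v$ into the edge. (i) Let $D$ be a non-empty set of vertices containing every pendant vertex. Then the eigenvalues of this problem, counted with multiplicity, form a sequence $\lambda_1(G,\ell;D)\le\lambda_2(G,\ell;D)\le\cdots$, and for every integer $j\ge 1$ $$\lambda_j(G,\ell;D)\le\frac{(j-2+2\beta+|D|)^2\pi^2}{L^2}.$$ (ii) If $G$ has no pendant vertices, then the eigenvalues of this problem with $D=\varnothing$ (Neumann conditions at every vertex),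 counted with multiplicity, form a sequence $\lambda_0(G,\ell)\le\lambda_1(G,\ell)\le\lambda_2(G,\ell)\le\cdots$, and for every integer $j\ge 1$ $$\lambda_j(G,\ell)\le\frac{(j-1+2\beta)^2\pi^2}{L^2}.$$ -/

import Mathlib

/-- A metric graph with vertex set `V` and edge set `E`; loops and multiple edges are allowed.
Every edge `e` has a length `length e > 0` and is identified with the interval `[0, length e]`, the
point `0` being glued to the vertex `src e` and the point `length e` to the vertex `tgt e`.
(The orientation only records the identification; it plays no other role.) -/
structure MetricGraph (V E : Type*) where
  /-- the vertex at the point `0` of the edge -/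
  src : E → V
  /-- the vertex at the point `length e` of the edge -/
  tgt : E → V
  /-- the length of the edge -/
  length : E → ℝ
  length_pos : ∀ e, 0 < length e

namespace MetricGraph

variable {V E : Type*}

/-- Two vertices are adjacent if some edge joins them, in either direction. -/
def Adj (G : MetricGraph V E) (u v : V) : Prop :=
  ∃ e, (G.src e = u ∧ G.tgt e = v) ∨ (G.src e = v ∧ G.tgt e = u)

/-- The graph is nonempty and any two vertices are joined by a walk. -/
def Connected (G : MetricGraph V E) : Prop :=
  Nonempty V ∧ ∀ u v : V, Relation.ReflTransGen G.Adj u v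

/-- The degree of a vertex: the number of edge ends at it (so a loop counts twice). -/
def degree [DecidableEq V] [Fintype E] (G : MetricGraph V E) (v : V) : ℕ :=
  (Finset.univ.filter fun e => G.src e = v).card + (Finset.univ.filter fun e => G.tgt e = v).card

/-- A pendant vertex is a vertex of degree one. -/
def IsPendant [DecidableEq V] [Fintype E] (G : MetricGraph V E) (v : V) : Prop :=
  G.degree v = 1

/-- The Betti number `m - n + 1` (of a connected graph). -/
def betti [Fintype V] [Fintype E] (_G : MetricGraph V E) : ℤ :=
  (Fintype.card E : ℤ) - (Fintype.card V : ℤ) + 1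

/-- The total length of the graph. -/
def totalLength [Fintype E] (G : MetricGraph V E) : ℝ :=
  ∑ e, G.length e

/-- `f` solves the eigenvalue problem for the Laplacian with parameter `μ`, with Dirichlet conditions
at the vertices in `D` and Neumann conditions at the other vertices (for `D = ∅` this is the Neumann
problem).  A function on the graph is given by its restrictions `f e` to the edges `[0, length e]`;
so that it is determined by its values on the graph, `f e` is taken to be `0` off this interval.
Here `φ` is the restriction of `f` to the vertices, `g e` is the derivative of `f e` on the
closed edge (one-sided at the ends), and continuity over the graph amounts to continuity on the
closed edges, which differentiability gives, and the compatibility at the vertices. -/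
def IsSolution [DecidableEq V] [Fintype E] (G : MetricGraph V E) (D : Finset V) (μ : ℝ)
    (f : E → ℝ → ℝ) : Prop :=
  (∀ e, ∀ x, x ∉ Set.Icc 0 (G.length e) → f e x = 0) ∧
  ∃ (φ : V → ℝ) (g : E → ℝ → ℝ),
    -- `f` takes the value `φ v` at the vertex `v`, along every edge that ends there
    (∀ e, f e 0 = φ (G.src e) ∧ f e (G.length e) = φ (G.tgt e)) ∧
    -- `f' = g` and `-f'' = μ f` on every edge
    (∀ e, ∀ x ∈ Set.Icc 0 (G.length e),
      HasDerivWithinAt (f e) (g e x) (Set.Icc 0 (G.length e)) x ∧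
      HasDerivWithinAt (g e) (-(μ * f e x)) (Set.Icc 0 (G.length e)) x) ∧
    -- Dirichlet conditions
    (∀ v ∈ D, φ v = 0) ∧
    -- Neumann conditions: the derivatives at `v`, in the directions away from `v`, sum to zero
    (∀ v, v ∉ D →
      (∑ e with G.src e = v, g e 0) + (∑ e with G.tgt e = v, -g e (G.length e)) = 0)

/-- The space of solutions of the eigenvalue problem with parameter `μ`. -/
def eigenspace [DecidableEq V] [Fintype E] (G : MetricGraph V E) (D : Finset V) (μ : ℝ) :
    Submodule ℝ (E → ℝ → ℝ) where
  carrier := {f | G.IsSolution D μ f}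
  zero_mem' := by
    refine ⟨fun _ _ _ => rfl, 0, 0, fun _ => ⟨rfl, rfl⟩, fun e x _ => ⟨?_, ?_⟩, fun _ _ => rfl, ?_⟩
    · exact hasDerivWithinAt_const x _ (0 : ℝ)
    · exact (hasDerivWithinAt_const x _ (0 : ℝ)).congr_deriv (by simp)
    · intro v _
      simp
  add_mem' := by
    rintro a b ⟨ha, φ, g, h1, h2, h3, h4⟩ ⟨hb, ψ, k, k1, k2, k3, k4⟩
    refine ⟨fun e x hx => by simp [ha e x hx, hb e x hx], φ + ψ, g + k, fun e => ?_,
      fun e x hx => ⟨?_, ?_⟩, fun v hv => by simp [h3 v hv, k3 v hv], fun v hv => ?_⟩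
    · simp [(h1 e).1, (h1 e).2, (k1 e).1, (k1 e).2]
    · exact (h2 e x hx).1.add (k2 e x hx).1
    · refine ((h2 e x hx).2.add (k2 e x hx).2).congr_deriv ?_
      simp only [Pi.add_apply]
      ring
    · have p := h4 v hv
      have q := k4 v hv
      simp only [Pi.add_apply, Finset.sum_add_distrib, Finset.sum_neg_distrib] at p q ⊢
      linarith
  smul_mem' := by
    rintro c a ⟨ha, φ, g, h1, h2, h3, h4⟩
    refine ⟨fun e x hx => by simp [ha e x hx], c • φ, c • g, fun e => ?_,
      fun e x hx => ⟨?_, ?_⟩, fun v hv => by simp [h3 v hv], fun v hv => ?_⟩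
    · simp [(h1 e).1, (h1 e).2]
    · exact (h2 e x hx).1.const_smul c
    · refine ((h2 e x hx).2.const_smul c).congr_deriv ?_
      simp only [Pi.smul_apply, smul_eq_mul]
      ring
    · have p := h4 v hv
      simp only [Pi.smul_apply, smul_eq_mul, ← mul_neg, ← Finset.mul_sum, ← mul_add]
      rw [p, mul_zero]

/-- The multiplicity of `μ` as an eigenvalue: the dimension of the solution space, in `ℕ∞`
(it is `0` if `μ` is not an eigenvalue). -/
noncomputable def multiplicity [DecidableEq V] [Fintype E] (G : MetricGraph V E) (D : Finset V)
    (μ : ℝ) : ℕ∞ :=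
  Cardinal.toENat (Module.rank ℝ (G.eigenspace D μ))

/-- `lam s ≤ lam (s + 1) ≤ ⋯` is the list of all eigenvalues with Dirichlet conditions at `D`
and Neumann conditions elsewhere, in nondecreasing order and repeated according to multiplicity.
The index starts at `s`; the values `lam j` with `j < s` are irrelevant. -/
def IsEigenvalueSequence [DecidableEq V] [Fintype E] (G : MetricGraph V E) (D : Finset V)
    (s : ℕ) (lam : ℕ → ℝ) : Prop :=
  (∀ i j, s ≤ i → i ≤ j → lam i ≤ lam j) ∧
  ∀ μ : ℝ, {j : ℕ | s ≤ j ∧ lam j = μ}.encard = G.multiplicity D μ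

end MetricGraph

section

/-! ### Compact symmetric operators on a real inner product space (completeness is not needed) -/

open scoped InnerProductSpace Topology

section CompactSymmetric

variable {X : Type*} [NormedAddCommGroup X] [InnerProductSpace ℝ X] {T : X →ₗ[ℝ] X} {K : Set X}

/-! By min-max it suffices to find, for each `k > 0`, a space of continuous functions vanishing on
`D`, of dimension `N` with `k * L ≤ π * (N + b)`, on which `∫ (w')² ≤ k² ∫ w²`. Here `b = -1 + 2 * β
+ |D|` in the Dirichlet case and `b = -1 + 2 * β` in the Neumann case. The eigenvalues up to `k²`
then have total multiplicity at least `N`. If `k` exceeds `(n + b) * π / L`, then `N > n`, and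
letting `k` decrease to this value bounds the eigenvalue with zero-based number `n`.

The test space is built by removing edges one at a time and keeping a phase in `[0, π)` at each
vertex. A phase `α v` adds `k cot (α v) φ(v)²` to the form; `0` stands for Dirichlet and `π / 2` for
Neumann. Along an edge the function `sin (k x + a)` carries the phase `a` at one end to `a + k ℓ = q
π + b` at the other, and cutting at its zeros gives `q` free amplitudes (`exists_edge_family`). The
edge is thereby replaced by a term `k cot b φ(w)²` at its far end `w`, to be merged with the phase
already there. Two merging phases lose at most `π` (`exists_merged_phase`). A vertex that no phase
has reached is counted with weight `π`, so that its first merger loses exactly `π` too. Each removal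
therefore consumes at most `π * (q + 1)` of total phase (`exists_absorb`).

Edges off a spanning tree are removed first, each after a Dirichlet condition costing at most `π`
more; then the tree is removed from the leaves to the root. The initial weight is `π * (n - |D|)`,
the final one is `0`, and the `n - 1` tree edges and `β` other edges give the bound on `N`. A vertex
outside `D` must be reached by a phase before its own tree edge is removed; the condition on pendant
vertices guarantees this. In the Neumann case the root is put at an end of an edge off the tree,
whose removal then needs no extra Dirichlet condition.

The spectral side works with the Green operator of `-u'' + u = f` on continuous functions with the
`L²` inner product. It is symmetric, nonnegative and compact, and `μ` is an eigenvalue of the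
problem exactly when `1 + μ > 0` and `(1 + μ)⁻¹` is an eigenvalue of the operator. -/

theorem exists_close_image_of_isCompact (hK : IsCompact K) (hTK : ∀ x, ‖x‖ ≤ 1 → T x ∈ K)
    {R : ℝ} (hR : 0 < R) (x : ℕ → X) (hx : ∀ n, ‖x n‖ ≤ R) {ε : ℝ} (hε : 0 < ε) :
    ∃ m n, m ≠ n ∧ ‖T (x m) - T (x n)‖ < ε := by
  have hmem : ∀ n, T (R⁻¹ • x n) ∈ K := fun n => hTK _ (by
    rw [norm_smul, norm_inv, Real.norm_of_nonneg hR.le, inv_mul_le_iff₀ hR, mul_one]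
    exact hx n)
  obtain ⟨y, -, φ, hφ, hlim⟩ := hK.tendsto_subseq hmem
  have hc := hlim.cauchySeq
  rw [Metric.cauchySeq_iff'] at hc
  obtain ⟨N, hN⟩ := hc (ε / R) (by positivity)
  refine ⟨φ (N + 1), φ N, fun h => by simpa using hφ.injective h, ?_⟩
  have h1 := hN (N + 1) (by omega)
  simp only [Function.comp_apply, map_smul, dist_eq_norm, ← smul_sub, norm_smul, norm_inv,
    Real.norm_of_nonneg hR.le] at h1
  rw [inv_mul_eq_div] at h1
  exact (div_lt_div_iff_of_pos_right hR).mp h1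

/-- Riesz's lemma gives a bounded 1-separated sequence in an infinite-dimensional space. On the
eigenspace the operator is multiplication by `κ`, so the images would stay `κ`-separated, against
compactness. -/
theorem finiteDimensional_eigenspace_of_isCompact (hK : IsCompact K)
    (hTK : ∀ x, ‖x‖ ≤ 1 → T x ∈ K) {κ : ℝ} (hκ : 0 < κ) :
    FiniteDimensional ℝ (Module.End.eigenspace T κ) := by
  by_contra h
  obtain ⟨R, f, hR, hf, hsep⟩ := exists_seq_norm_le_one_le_norm_sub h
  obtain ⟨m, n, hmn, hlt⟩ := exists_close_image_of_isCompact hK hTK (by linarith : 0 < R)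
    (fun n => (f n : X)) (fun n => hf n) hκ
  rw [Module.End.mem_eigenspace_iff.mp (f m).2, Module.End.mem_eigenspace_iff.mp (f n).2,
    ← smul_sub, norm_smul, Real.norm_of_nonneg hκ.le] at hlt
  have h1 : 1 ≤ ‖(f m : X) - f n‖ := hsep hmn
  nlinarith

/-- Unit eigenvectors for distinct eigenvalues are orthogonal, so their images lie at distance `√(κ²
+ κ'²) ≥ κ₀` from each other; compactness allows only finitely many. -/
theorem finite_eigenvalues_ge_of_isCompact (hT : T.IsSymmetric) (hK : IsCompact K)
    (hTK : ∀ x, ‖x‖ ≤ 1 → T x ∈ K) {κ₀ : ℝ} (hκ₀ : 0 < κ₀) :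
    {κ : ℝ | κ₀ ≤ κ ∧ Module.End.HasEigenvalue T κ}.Finite := by
  by_contra hinf
  obtain ⟨κ, hκ⟩ : ∃ κ : ℕ → {κ : ℝ | κ₀ ≤ κ ∧ Module.End.HasEigenvalue T κ},
      Function.Injective κ :=
    ⟨_, ((Set.not_finite.mp hinf) |>.natEmbedding).injective⟩
  have hex : ∀ n, ∃ z : X, T z = (κ n : ℝ) • z ∧ ‖z‖ = 1 := fun n => by
    obtain ⟨z, hz⟩ := (κ n).2.2.exists_hasEigenvector
    refine ⟨‖z‖⁻¹ • z, ?_, norm_smul_inv_norm hz.2⟩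
    rw [map_smul, hz.apply_eq_smul, smul_comm]
  choose z hz hz1 using hex
  obtain ⟨m, n, hmn, hlt⟩ := exists_close_image_of_isCompact hK hTK one_pos z
    (fun n => (hz1 n).le) hκ₀
  have hne : (κ m : ℝ) ≠ κ n := fun h => hmn (hκ (Subtype.ext h))
  have horth : ⟪z m, z n⟫_ℝ = 0 := by
    have h1 := hT (z m) (z n)
    rw [hz, hz, real_inner_smul_left, real_inner_smul_right] at h1
    have h2 : ((κ m : ℝ) - κ n) * ⟪z m, z n⟫_ℝ = 0 := by linarith
    exact (mul_eq_zero.mp h2).resolve_left (sub_ne_zero.mpr hne)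
  have h3 : ‖T (z m) - T (z n)‖ ^ 2 = (κ m : ℝ) ^ 2 + (κ n : ℝ) ^ 2 := by
    rw [hz, hz, norm_sub_sq_real, real_inner_smul_left, real_inner_smul_right, horth, norm_smul,
      norm_smul, hz1, hz1]
    simp
  have h4 : κ₀ ≤ κ m := (κ m).2.1
  nlinarith [norm_nonneg (T (z m) - T (z n)), sq_nonneg (κ n : ℝ)]

/-- A vector orthogonal to all eigenvectors with eigenvalue at least `κ₀` has Rayleigh quotient
less than `κ₀`. -/
theorem eq_zero_of_orthogonal_eigenspaces (hT : T.IsSymmetric) (hK : IsCompact K)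
    (hTK : ∀ x, ‖x‖ ≤ 1 → T x ∈ K) (hpos : ∀ x, 0 ≤ ⟪T x, x⟫_ℝ) {κ₀ : ℝ} (hκ₀ : 0 < κ₀) {w : X}
    (hw : ∀ κ, κ₀ ≤ κ → ∀ z, T z = κ • z → ⟪z, w⟫_ℝ = 0)
    (hle : κ₀ * ‖w‖ ^ 2 ≤ ⟪T w, w⟫_ℝ) : w = 0 := by
  by_contra hw0
  obtain ⟨C, hC⟩ := hK.isBounded.exists_norm_le
  have hbound : ∀ x, ‖T x‖ ≤ C * ‖x‖ := fun x => by
    by_cases hx : x = 0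
    · simp [hx]
    have hx' : 0 < ‖x‖ := norm_pos_iff.mpr hx
    have h1 := hC _ (hTK (‖x‖⁻¹ • x) (norm_smul_inv_norm hx).le)
    rw [map_smul, norm_smul, norm_inv, norm_norm, inv_mul_le_iff₀ hx'] at h1
    linarith
  have hcont : Continuous T := AddMonoidHomClass.continuous_of_bound T C hbound
  -- The supremum `M` of the Rayleigh quotient on this invariant closed set will be attained at an
  -- eigenvector with eigenvalue `M ≥ κ₀`, which is then orthogonal to itself.
  let Y : Set X := {x | ∀ κ, κ₀ ≤ κ → ∀ z, T z = κ • z → ⟪z, x⟫_ℝ = 0}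
  have hYclosed : IsClosed Y := by
    simp only [Y, Set.ofPred_forall]
    exact isClosed_iInter fun κ => isClosed_iInter fun _ => isClosed_iInter fun z =>
      isClosed_iInter fun _ => isClosed_eq (by fun_prop) continuous_const
  let S : Set ℝ := {t | ∃ x ∈ Y, ‖x‖ = 1 ∧ t = ⟪T x, x⟫_ℝ}
  have hSbdd : BddAbove S := ⟨C, by
    rintro _ ⟨x, -, hx1, rfl⟩
    have := real_inner_le_norm (T x) x
    have := hbound x
    rw [hx1] at *
    linarith⟩
  have hw0' : 0 < ‖w‖ := norm_pos_iff.mpr hw0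
  have hwS : ⟪T (‖w‖⁻¹ • w), ‖w‖⁻¹ • w⟫_ℝ ∈ S := ⟨_, fun κ hκ z hz => by
    rw [real_inner_smul_right, hw κ hκ z hz, mul_zero], norm_smul_inv_norm hw0, rfl⟩
  set M := sSup S with hM
  have hMκ : κ₀ ≤ M := by
    refine le_trans ?_ (le_csSup hSbdd hwS)
    rw [map_smul, real_inner_smul_left, real_inner_smul_right, ← mul_assoc, ← mul_inv,
      ← div_eq_inv_mul, le_div_iff₀ (by positivity)]
    nlinarith
  have hM0 : 0 < M := hκ₀.trans_le hMκ
  have hray : ∀ x ∈ Y, ⟪T x, x⟫_ℝ ≤ M * ‖x‖ ^ 2 := fun x hx => by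
    by_cases hx0 : x = 0
    · simp [hx0]
    have hx' : 0 < ‖x‖ := norm_pos_iff.mpr hx0
    have h1 : ⟪T (‖x‖⁻¹ • x), ‖x‖⁻¹ • x⟫_ℝ ≤ M := le_csSup hSbdd ⟨_, fun κ hκ z hz => by
      rw [real_inner_smul_right, hx κ hκ z hz, mul_zero], norm_smul_inv_norm hx0, rfl⟩
    rw [map_smul, real_inner_smul_left, real_inner_smul_right, ← mul_assoc, ← mul_inv,
      ← div_eq_inv_mul, div_le_iff₀ (by positivity)] at h1
    nlinarith
  -- `‖T x‖² ≤ M ⟪T x, x⟫` on `Y`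
  have hTY : ∀ x ∈ Y, T x ∈ Y := fun x hx κ hκ z hz => by
    rw [← hT, hz, real_inner_smul_left, hx κ hκ z hz, mul_zero]
  have hYadd : ∀ x ∈ Y, ∀ y ∈ Y, ∀ t : ℝ, x + t • y ∈ Y := fun x hx y hy t κ hκ z hz => by
    rw [inner_add_right, real_inner_smul_right, hx κ hκ z hz, hy κ hκ z hz]; simp
  have hsq : ∀ x ∈ Y, ‖T x‖ ^ 2 ≤ M * ⟪T x, x⟫_ℝ := fun x hx => by
    -- Positivity at `x - M⁻¹ T x` reads `⟪T x, x⟫ - 2 M⁻¹ ‖T x‖² + M⁻² ⟪T (T x), T x⟫ ≥ 0`, and the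
    -- last term is at most `M⁻¹ ‖T x‖²` since `T x` lies in `Y`.
    have h1 := hpos (x + (-M⁻¹) • T x)
    have h2 := hray _ (hTY x hx)
    have h3 : ⟪T (T x), x⟫_ℝ = ‖T x‖ ^ 2 := by rw [hT, real_inner_self_eq_norm_sq]
    rw [map_add, map_smul, inner_add_left, inner_add_right, inner_add_right, real_inner_smul_left,
      real_inner_smul_left, real_inner_smul_right, real_inner_smul_right, h3,
      real_inner_self_eq_norm_sq] at h1
    have h4 : M⁻¹ * M = 1 := inv_mul_cancel₀ hM0.ne'
    have h5 : M⁻¹ * (M⁻¹ * ⟪T (T x), T x⟫_ℝ) ≤ M⁻¹ * ‖T x‖ ^ 2 := by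
      have : M⁻¹ * ⟪T (T x), T x⟫_ℝ ≤ ‖T x‖ ^ 2 := by
        rw [inv_mul_le_iff₀ hM0]; exact h2
      exact mul_le_mul_of_nonneg_left this (by positivity)
    have h6 : M⁻¹ * ‖T x‖ ^ 2 ≤ ⟪T x, x⟫_ℝ := by nlinarith
    rwa [inv_mul_le_iff₀ hM0] at h6
  have hex : ∀ n : ℕ, ∃ x ∈ Y, ‖x‖ = 1 ∧ M - 1 / ((n : ℝ) + 1) < ⟪T x, x⟫_ℝ := fun n => by
    obtain ⟨t, ⟨x, hx, hx1, rfl⟩, hlt⟩ := exists_lt_of_lt_csSup ⟨_, hwS⟩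
      (show M - 1 / ((n : ℝ) + 1) < sSup S by
        have : 0 < 1 / ((n : ℝ) + 1) := by positivity
        linarith)
    exact ⟨x, hx, hx1, hlt⟩
  choose x hxY hx1 hxM using hex
  have hdist : ∀ n, ‖T (x n) - M • x n‖ ^ 2 ≤ M * (1 / ((n : ℝ) + 1)) := fun n => by
    rw [norm_sub_sq_real, real_inner_smul_right, norm_smul, hx1, Real.norm_of_nonneg hM0.le]
    nlinarith [hsq _ (hxY n), hxM n]
  have hdist0 : Filter.Tendsto (fun n => T (x n) - M • x n) Filter.atTop (𝓝 0) := by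
    rw [tendsto_zero_iff_norm_tendsto_zero]
    have h1 : Filter.Tendsto (fun n => ‖T (x n) - M • x n‖ ^ 2) Filter.atTop (𝓝 0) :=
      squeeze_zero (fun n => by positivity) hdist (by
        simpa using tendsto_one_div_add_atTop_nhds_zero_nat.const_mul M)
    have h2 := h1.sqrt
    simpa [Real.sqrt_sq (norm_nonneg _)] using h2
  -- Compactness makes `T (x n)` converge along a subsequence. As `T (x n) - M • x n` tends to `0`,
  -- so does `x n` converge, with a limit in `X` even though `X` need not be complete.
  obtain ⟨y, -, φ, hφ, hlim⟩ := hK.tendsto_subseq fun n => hTK (x n) (hx1 n).le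
  have hlim2 : Filter.Tendsto (fun n => x (φ n)) Filter.atTop (𝓝 (M⁻¹ • y)) := by
    have h1 := (hlim.sub (hdist0.comp hφ.tendsto_atTop)).const_smul M⁻¹
    simpa [smul_smul, inv_mul_cancel₀ hM0.ne'] using h1
  set v := M⁻¹ • y with hv
  have hvY : v ∈ Y := hYclosed.mem_of_tendsto hlim2 (Filter.Eventually.of_forall fun n => hxY _)
  have hv1 : ‖v‖ = 1 := by
    have := hlim2.norm
    simp only [hx1] at this
    exact (tendsto_nhds_unique this tendsto_const_nhds)
  have hTv : T v = M • v := by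
    have h1 := tendsto_nhds_unique ((hcont.tendsto v).comp hlim2) hlim
    rw [h1, hv, smul_smul, mul_inv_cancel₀ hM0.ne', one_smul]
  have h0 := hvY M hMκ v hTv
  rw [real_inner_self_eq_norm_sq, hv1] at h0
  norm_num at h0

/-- Min-max: a space of dimension `N` with Rayleigh quotients at least `κ₀` forces the
eigenvalues that are at least `κ₀` to have total multiplicity at least `N`. -/
theorem card_le_sum_finrank_eigenspace (hT : T.IsSymmetric) (hK : IsCompact K)
    (hTK : ∀ x, ‖x‖ ≤ 1 → T x ∈ K) (hpos : ∀ x, 0 ≤ ⟪T x, x⟫_ℝ) {κ₀ : ℝ} (hκ₀ : 0 < κ₀)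
    (s : Finset ℝ) (hs : ∀ κ, κ₀ ≤ κ → Module.End.HasEigenvalue T κ → κ ∈ s)
    (hs' : ∀ κ ∈ s, 0 < κ)
    {ι : Type*} [Fintype ι] (W : (ι → ℝ) →ₗ[ℝ] X) (hW : Function.Injective W)
    (hle : ∀ c, κ₀ * ‖W c‖ ^ 2 ≤ ⟪T (W c), W c⟫_ℝ) :
    Fintype.card ι ≤ ∑ κ ∈ s, Module.finrank ℝ (Module.End.eigenspace T κ) := by
  by_contra! hlt
  have hfd : ∀ κ : s, FiniteDimensional ℝ (Module.End.eigenspace T (κ : ℝ)) := fun κ =>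
    finiteDimensional_eigenspace_of_isCompact hK hTK (hs' κ κ.2)
  let L : (ι → ℝ) →ₗ[ℝ] ((κ : s) → Module.Dual ℝ (Module.End.eigenspace T (κ : ℝ))) :=
    LinearMap.pi fun κ =>
      (LinearMap.lcomp ℝ ℝ (Module.End.eigenspace T (κ : ℝ)).subtype) ∘ₗ (innerₗ X) ∘ₗ W
  -- Fewer linear conditions than parameters: some nonzero `W c` is orthogonal to all eigenspaces
  -- with index in `s`.
  have hker : ¬ Function.Injective L := fun hinj => by
    have h1 := LinearMap.finrank_le_finrank_of_injective hinj
    rw [Module.finrank_fintype_fun_eq_card, Module.finrank_pi_fintype] at h1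
    simp only [Subspace.dual_finrank_eq] at h1
    rw [Finset.sum_coe_sort s fun κ => Module.finrank ℝ (Module.End.eigenspace T κ)] at h1
    omega
  rw [← LinearMap.ker_eq_bot, Submodule.eq_bot_iff] at hker
  push Not at hker
  obtain ⟨c, hc, hc0⟩ := hker
  refine hc0 (hW ?_)
  rw [map_zero]
  refine eq_zero_of_orthogonal_eigenspaces hT hK hTK hpos hκ₀ (fun κ hκ z hz => ?_) (hle c)
  by_cases hz0 : z = 0
  · simp [hz0]
  have hzm : z ∈ Module.End.eigenspace T κ := Module.End.mem_eigenspace_iff.mpr hz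
  have hκs : κ ∈ s := hs κ hκ (Module.End.hasEigenvalue_of_hasEigenvector ⟨hzm, hz0⟩)
  have h1 := congrFun (LinearMap.mem_ker.mp hc) ⟨κ, hκs⟩
  have h2 := LinearMap.congr_fun h1 ⟨z, hzm⟩
  rw [real_inner_comm]
  simpa [L] using h2

end CompactSymmetric

end

section

/-! ### Nondecreasing sequences with prescribed multiplicities -/

section Sequences

/-- A multiplicity function with finite support below every bound and infinite total mass is the
multiplicity function of a nondecreasing sequence. -/
theorem exists_monotone_seq_of_multiplicity (m : ℝ → ℕ)
    (hfin : ∀ t : ℝ, {μ | μ ≤ t ∧ m μ ≠ 0}.Finite)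
    (hinf : ∀ n : ℕ, ∃ t : ℝ, n ≤ ∑ μ ∈ (hfin t).toFinset, m μ) (s : ℕ) :
    ∃ lam : ℕ → ℝ, (∀ i j, s ≤ i → i ≤ j → lam i ≤ lam j) ∧
      ∀ μ : ℝ, {j : ℕ | s ≤ j ∧ lam j = μ}.encard = m μ := by
  set P : ℝ → Finset ℝ := fun t => (hfin t).toFinset with hP
  set c : ℝ → ℕ := fun t => ∑ μ ∈ P t, m μ with hc
  have hmem : ∀ t μ, μ ∈ P t ↔ μ ≤ t ∧ m μ ≠ 0 := fun t μ => by simp [hP]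
  have hmono : Monotone c := fun a b hab => Finset.sum_le_sum_of_subset fun μ hμ => by
    rw [hmem] at hμ ⊢
    exact ⟨hμ.1.trans hab, hμ.2⟩
  have hleast : ∀ j : ℕ, ∃ μ, IsLeast {t | j < c t} μ := fun j => by
    obtain ⟨t, ht⟩ := hinf (j + 1)
    have hmax : ∀ t, j < c t → ∃ ν ∈ P t, j < c ν := fun t ht => by
      have hne : (P t).Nonempty := by
        by_contra h
        rw [Finset.not_nonempty_iff_eq_empty] at h
        simp [hc, h] at ht
      refine ⟨(P t).max' hne, Finset.max'_mem _ _, ht.trans_le ?_⟩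
      refine Finset.sum_le_sum_of_subset fun μ hμ => ?_
      rw [hmem]
      exact ⟨Finset.le_max' _ _ hμ, ((hmem _ _).mp hμ).2⟩
    have ht' : j < c t := ht
    obtain ⟨ν, hν, hjν⟩ := hmax t ht'
    have hne : ((P t).filter fun ν => j < c ν).Nonempty :=
      ⟨ν, Finset.mem_filter.mpr ⟨hν, hjν⟩⟩
    refine ⟨((P t).filter fun ν => j < c ν).min' hne, ?_, fun t' ht'' => ?_⟩
    · exact (Finset.mem_filter.mp (Finset.min'_mem _ hne)).2
    · obtain ⟨ν', hν', hjν'⟩ := hmax t' ht''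
      rcases le_total t' t with h | h
      · refine (Finset.min'_le _ ν' (Finset.mem_filter.mpr ⟨?_, hjν'⟩)).trans
          ((hmem _ _).mp hν').1
        rw [hmem] at hν' ⊢
        exact ⟨hν'.1.trans h, hν'.2⟩
      · exact (Finset.min'_le _ ν (Finset.mem_filter.mpr ⟨hν, hjν⟩)).trans
          (((hmem _ _).mp hν).1.trans h)
  choose f hf using hleast
  -- The sequence is the quantile function of the counting function `c`; this Galois connection
  -- carries the rest. The entries equal to `μ` are those with index from the count strictly below
  -- `μ` up to `c μ`.
  have hgal : ∀ j t, f j ≤ t ↔ j < c t := fun j t =>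
    ⟨fun h => lt_of_lt_of_le (hf j).1 (hmono h), fun h => (hf j).2 h⟩
  refine ⟨fun j => f (j - s), fun i j _ hij => ?_, fun μ => ?_⟩
  · rw [hgal]
    exact lt_of_le_of_lt (by omega) (hf (j - s)).1
  -- the number of entries below `μ`
  set b : ℕ := ∑ ν ∈ (P μ).erase μ, m ν with hb
  have hcb : c μ = b + m μ := by
    by_cases h : μ ∈ P μ
    · rw [hb, Finset.sum_erase_add _ _ h]
    · have h0 : m μ = 0 := by
        by_contra h0
        exact h ((hmem _ _).mpr ⟨le_rfl, h0⟩)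
      rw [hb, Finset.erase_eq_of_notMem h, h0, add_zero]
  have hlow : ∀ ν < μ, c ν ≤ b := fun ν hν => Finset.sum_le_sum_of_subset fun x hx => by
    rw [hmem] at hx
    rw [Finset.mem_erase, hmem]
    exact ⟨(hx.1.trans_lt hν).ne, hx.1.trans hν.le, hx.2⟩
  have hset : {j : ℕ | s ≤ j ∧ f (j - s) = μ} = ((Finset.Ico b (c μ)).image (· + s) : Finset ℕ) := by
    ext j
    simp only [Set.mem_ofPred_eq, Finset.coe_image, Set.mem_image, Finset.coe_Ico, Set.mem_Ico]
    constructor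
    · rintro ⟨hj, hfj⟩
      refine ⟨j - s, ⟨?_, (hgal _ _).mp hfj.le⟩, by omega⟩
      by_contra! hlt
      have hne : ((P μ).erase μ).Nonempty := by
        by_contra h
        rw [Finset.not_nonempty_iff_eq_empty] at h
        simp [hb, h] at hlt
      set ν := ((P μ).erase μ).max' hne
      have hν : ν ∈ (P μ).erase μ := Finset.max'_mem _ _
      have hbν : b ≤ c ν := Finset.sum_le_sum_of_subset fun x hx => by
        rw [hmem]
        exact ⟨Finset.le_max' _ _ hx, ((hmem _ _).mp (Finset.mem_of_mem_erase hx)).2⟩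
      have h1 := (hgal (j - s) ν).mpr (by omega)
      rw [hfj] at h1
      exact (Finset.ne_of_mem_erase hν) (le_antisymm
        ((hmem _ _).mp (Finset.mem_of_mem_erase hν)).1 h1)
    · rintro ⟨i, ⟨hi1, hi2⟩, rfl⟩
      refine ⟨by omega, ?_⟩
      rw [Nat.add_sub_cancel]
      refine le_antisymm ((hgal _ _).mpr hi2) ?_
      by_contra! hlt
      have := hlow _ hlt
      have := (hf i).1
      simp only [Set.mem_ofPred_eq] at this
      omega
  rw [hset, Set.encard_coe_eq_coe_finsetCard,
    Finset.card_image_of_injective _ (add_left_injective s), Nat.card_Ico, hcb]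
  simp

/-- If the multiplicities up to `t` add up to at least `n + 1`, then the entry with (zero-based)
number `n` of the sequence is at most `t`. -/
theorem seq_le_of_lt_sum_multiplicity {m : ℝ → ℕ} {s : ℕ} {lam : ℕ → ℝ}
    (hmono : ∀ i j, s ≤ i → i ≤ j → lam i ≤ lam j)
    (hcard : ∀ μ : ℝ, {j : ℕ | s ≤ j ∧ lam j = μ}.encard = m μ)
    {t : ℝ} {P : Finset ℝ} (hP : ∀ μ ∈ P, μ ≤ t) {n : ℕ} (hn : n < ∑ μ ∈ P, m μ) :
    lam (s + n) ≤ t := by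
  by_contra! hlt
  have hfin : ∀ μ, {j : ℕ | s ≤ j ∧ lam j = μ}.Finite := fun μ => by
    rw [← Set.encard_ne_top_iff, hcard]
    exact ENat.natCast_ne_top _
  have hsub : P.biUnion (fun μ => (hfin μ).toFinset) ⊆ Finset.Ico s (s + n) := fun j hj => by
    simp only [Finset.mem_biUnion, Set.Finite.mem_toFinset, Set.mem_ofPred_eq] at hj
    obtain ⟨μ, hμ, hsj, rfl⟩ := hj
    rw [Finset.mem_Ico]
    refine ⟨hsj, ?_⟩
    by_contra! h
    exact absurd (hmono _ _ (by omega) h) (not_le.mpr ((hP _ hμ).trans_lt hlt))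
  have h1 := Finset.card_le_card hsub
  rw [Finset.card_biUnion, Nat.card_Ico] at h1
  · have h2 : ∀ μ, (hfin μ).toFinset.card = m μ := fun μ => by
      have := hcard μ
      rw [(hfin μ).encard_eq_coe_toFinset_card] at this
      exact_mod_cast this
    simp only [h2] at h1
    omega
  · intro a _ b _ hab
    rw [Function.onFun, Finset.disjoint_left]
    intro j hj hj'
    simp only [Set.Finite.mem_toFinset, Set.mem_ofPred_eq] at hj hj'
    exact hab (hj.2.symm.trans hj'.2)

end Sequences

end

section

open Set MeasureTheory

/-! ### Test functions on an interval -/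

/-- `w` is continuous on `[0, ℓ]` with bounded weak derivative `g`. -/
structure IsTest (ℓ : ℝ) (w g : ℝ → ℝ) : Prop where
  cont : ContinuousOn w (Icc 0 ℓ)
  int : IntervalIntegrable g volume 0 ℓ
  bdd : ∃ C, ∀ x ∈ Icc 0 ℓ, |g x| ≤ C
  parts : ∀ p p' : ℝ → ℝ, (∀ x ∈ Icc 0 ℓ, HasDerivWithinAt p (p' x) (Icc 0 ℓ) x) →
    ContinuousOn p' (Icc 0 ℓ) →
    ∫ x in (0 : ℝ)..ℓ, p x * g x = p ℓ * w ℓ - p 0 * w 0 - ∫ x in (0 : ℝ)..ℓ, p' x * w x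

/-- The quadratic form `∫ (w')² - k² ∫ w²` of the function `w` with derivative `g`. -/
noncomputable def edgeForm (k ℓ : ℝ) (w g : ℝ → ℝ) : ℝ :=
  ∫ x in (0 : ℝ)..ℓ, (g x ^ 2 - k ^ 2 * w x ^ 2)

/-- The concatenation of a function on `[0, a]` with a function on an interval starting at `0`. -/
noncomputable def concat (a : ℝ) (w₁ w₂ : ℝ → ℝ) (x : ℝ) : ℝ :=
  if x ≤ a then w₁ x else w₂ (x - a)

theorem isTest_of_hasDerivWithinAt {ℓ : ℝ} (hℓ : 0 ≤ ℓ) {w g : ℝ → ℝ}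
    (hw : ∀ x ∈ Icc 0 ℓ, HasDerivWithinAt w (g x) (Icc 0 ℓ) x) (hg : ContinuousOn g (Icc 0 ℓ)) :
    IsTest ℓ w g where
  cont x hx := (hw x hx).continuousWithinAt
  int := by
    rw [← uIcc_of_le hℓ] at hg
    exact hg.intervalIntegrable
  bdd := by
    obtain ⟨C, hC⟩ := isCompact_Icc.exists_bound_of_continuousOn hg
    exact ⟨C, hC⟩
  parts p p' hp hp' := by
    rw [← uIcc_of_le hℓ] at *
    exact intervalIntegral.integral_mul_deriv_eq_deriv_mul_of_hasDerivWithinAt hp hw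
      hp'.intervalIntegrable hg.intervalIntegrable

theorem IsTest.intervalIntegrable_mul {ℓ : ℝ} (hℓ : 0 ≤ ℓ) {w g w' g' : ℝ → ℝ}
    (h : IsTest ℓ w g) (h' : IsTest ℓ w' g') :
    IntervalIntegrable (fun x => g x * g' x) volume 0 ℓ := by
  obtain ⟨C, hC⟩ := h.bdd
  have h1 := h.int
  have h2 := h'.int
  rw [intervalIntegrable_iff_integrableOn_Ioc_of_le hℓ] at *
  refine Integrable.bdd_mul (c := C) h2 h1.aestronglyMeasurable ?_
  filter_upwards [ae_restrict_mem measurableSet_Ioc] with x hx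
  exact hC x (Ioc_subset_Icc_self hx)

theorem IsTest.intervalIntegrable_fun {ℓ : ℝ} (hℓ : 0 ≤ ℓ) {w g : ℝ → ℝ} (h : IsTest ℓ w g) :
    IntervalIntegrable w volume 0 ℓ := by
  have := h.cont
  rw [← uIcc_of_le hℓ] at this
  exact this.intervalIntegrable

theorem IsTest.intervalIntegrable_form {ℓ : ℝ} (hℓ : 0 ≤ ℓ) {w g : ℝ → ℝ} (h : IsTest ℓ w g)
    (k : ℝ) : IntervalIntegrable (fun x => g x ^ 2 - k ^ 2 * w x ^ 2) volume 0 ℓ := by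
  have h1 := h.intervalIntegrable_mul hℓ h
  have h2 : ContinuousOn (fun x => k ^ 2 * w x ^ 2) (uIcc 0 ℓ) := by
    have := h.cont
    rw [uIcc_of_le hℓ]
    fun_prop
  simpa only [pow_two] using h1.sub (by simpa only [pow_two] using h2.intervalIntegrable)

theorem IsTest.reflect {ℓ : ℝ} {w g : ℝ → ℝ} (h : IsTest ℓ w g) :
    IsTest ℓ (fun x => w (ℓ - x)) (fun x => -g (ℓ - x)) where
  cont := h.cont.comp (by fun_prop) fun x hx => ⟨by linarith [hx.2], by linarith [hx.1]⟩
  int := by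
    have := (h.int.comp_sub_left ℓ).symm
    rw [sub_self, sub_zero] at this
    exact this.neg
  bdd := by
    obtain ⟨C, hC⟩ := h.bdd
    refine ⟨C, fun x hx => ?_⟩
    rw [abs_neg]
    exact hC _ ⟨by linarith [hx.2], by linarith [hx.1]⟩
  parts p p' hp hp' := by
    have hmaps : MapsTo (fun x => ℓ - x) (Icc 0 ℓ) (Icc 0 ℓ) :=
      fun x hx => ⟨by linarith [hx.2], by linarith [hx.1]⟩
    have h1 := h.parts (fun x => p (ℓ - x)) (fun x => -p' (ℓ - x)) (fun x hx => by
      have h2 := (hp (ℓ - x) (hmaps hx)).scomp x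
        ((hasDerivAt_id x).const_sub ℓ).hasDerivWithinAt hmaps
      simpa [Function.comp_def] using h2) ((hp'.comp (by fun_prop) hmaps).neg)
    have h3 := intervalIntegral.integral_comp_sub_left (a := 0) (b := ℓ)
      (fun x => p x * -g (ℓ - x)) ℓ
    have h4 := intervalIntegral.integral_comp_sub_left (a := 0) (b := ℓ)
      (fun x => p' x * w (ℓ - x)) ℓ
    simp only [sub_sub_cancel, sub_self, sub_zero, mul_neg, neg_mul,
      intervalIntegral.integral_neg] at h1 h3 h4 ⊢
    linarith

theorem edgeForm_reflect (k ℓ : ℝ) (w g : ℝ → ℝ) :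
    edgeForm k ℓ (fun x => w (ℓ - x)) (fun x => -g (ℓ - x)) = edgeForm k ℓ w g := by
  have h := intervalIntegral.integral_comp_sub_left (a := 0) (b := ℓ)
      (fun x => g x ^ 2 - k ^ 2 * w x ^ 2) ℓ
  simpa [edgeForm] using h

theorem IsTest.congr {ℓ : ℝ} {w w' g : ℝ → ℝ} (h : IsTest ℓ w g)
    (hw : ∀ x ∈ Icc 0 ℓ, w' x = w x) (hℓ : 0 ≤ ℓ) : IsTest ℓ w' g where
  cont := h.cont.congr hw
  int := h.int
  bdd := h.bdd
  parts p p' hp hp' := by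
    have h1 : ∫ x in (0 : ℝ)..ℓ, p' x * w' x = ∫ x in (0 : ℝ)..ℓ, p' x * w x :=
      intervalIntegral.integral_congr fun x hx => by
        rw [uIcc_of_le hℓ] at hx
        simp only [hw x hx]
    rw [h.parts p p' hp hp', h1, hw 0 ⟨le_rfl, hℓ⟩, hw ℓ ⟨hℓ, le_rfl⟩]

theorem concat_of_le {a x : ℝ} (w₁ w₂ : ℝ → ℝ) (hx : x ≤ a) : concat a w₁ w₂ x = w₁ x := if_pos hx

theorem concat_of_ge {a x : ℝ} {w₁ w₂ : ℝ → ℝ} (h : w₁ a = w₂ 0) (hx : a ≤ x) :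
    concat a w₁ w₂ x = w₂ (x - a) := by
  rcases hx.eq_or_lt with rfl | hx
  · rw [concat_of_le _ _ le_rfl, h, sub_self]
  · exact if_neg (not_le.mpr hx)

theorem concat_of_gt {a x : ℝ} {w₁ w₂ : ℝ → ℝ} (hx : a < x) :
    concat a w₁ w₂ x = w₂ (x - a) := if_neg (not_le.mpr hx)

/-- Splitting an integral over a concatenated interval. -/
theorem integral_concat {a b : ℝ} (ha : 0 ≤ a) (hb : 0 ≤ b) {f f₁ f₂ : ℝ → ℝ}
    (h₁ : ∀ x ∈ Icc 0 a, f x = f₁ x) (h₂ : ∀ x, a < x → f x = f₂ (x - a))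
    (hf₁ : IntervalIntegrable f₁ volume 0 a) (hf₂ : IntervalIntegrable f₂ volume 0 b) :
    IntervalIntegrable f volume 0 (a + b) ∧
      ∫ x in (0 : ℝ)..(a + b), f x = (∫ x in (0 : ℝ)..a, f₁ x) + ∫ x in (0 : ℝ)..b, f₂ x := by
  have e₁ : EqOn f₁ f (uIoc 0 a) := fun x hx => by
    rw [uIoc_of_le ha] at hx
    exact (h₁ x (Ioc_subset_Icc_self hx)).symm
  have e₂ : EqOn (fun x => f₂ (x - a)) f (uIoc a (a + b)) := fun x hx => by
    rw [uIoc_of_le (by linarith)] at hx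
    exact (h₂ x hx.1).symm
  have i₁ : IntervalIntegrable f volume 0 a := hf₁.congr e₁
  have i₂ : IntervalIntegrable f volume a (a + b) := by
    have := hf₂.comp_sub_right a
    rw [zero_add, add_comm b a] at this
    exact this.congr e₂
  refine ⟨i₁.trans i₂, ?_⟩
  rw [← intervalIntegral.integral_add_adjacent_intervals i₁ i₂]
  congr 1
  · exact intervalIntegral.integral_congr_ae (ae_of_all _ fun x hx => (e₁ hx).symm)
  · rw [← intervalIntegral.integral_congr_ae (ae_of_all _ fun x hx => e₂ hx),
      intervalIntegral.integral_comp_sub_right]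
    simp

/-- In the integrations by parts on the two pieces the boundary terms at `a` cancel because the
values agree. The derivative may jump there, which is why test functions need only a bounded weak
derivative. -/
theorem IsTest.concat {a b : ℝ} (ha : 0 ≤ a) (hb : 0 ≤ b) {w₁ g₁ w₂ g₂ : ℝ → ℝ}
    (h₁ : IsTest a w₁ g₁) (h₂ : IsTest b w₂ g₂) (h : w₁ a = w₂ 0) :
    IsTest (a + b) (concat a w₁ w₂) (concat a g₁ g₂) where
  cont := by
    have hunion : Icc 0 (a + b) = Icc 0 a ∪ Icc a (a + b) :=
      (Icc_union_Icc_eq_Icc ha (by linarith)).symm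
    rw [hunion]
    refine ContinuousOn.union_of_isClosed ?_ ?_ isClosed_Icc isClosed_Icc
    · exact h₁.cont.congr fun x hx => concat_of_le _ _ hx.2
    · refine ContinuousOn.congr (f := fun x => w₂ (x - a)) ?_ fun x hx => concat_of_ge h hx.1
      exact h₂.cont.comp (by fun_prop) fun x hx => ⟨by linarith [hx.1], by linarith [hx.2]⟩
  int := (integral_concat ha hb (fun x hx => concat_of_le _ _ hx.2)
    (fun x hx => concat_of_gt hx) h₁.int h₂.int).1
  bdd := by
    obtain ⟨C₁, hC₁⟩ := h₁.bdd
    obtain ⟨C₂, hC₂⟩ := h₂.bdd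
    refine ⟨max C₁ C₂, fun x hx => ?_⟩
    rcases le_or_gt x a with hxa | hxa
    · rw [concat_of_le _ _ hxa]
      exact (hC₁ x ⟨hx.1, hxa⟩).trans (le_max_left _ _)
    · rw [concat_of_gt hxa]
      exact (hC₂ _ ⟨by linarith, by linarith [hx.2]⟩).trans (le_max_right _ _)
  parts p p' hp hp' := by
    have hpc : ContinuousOn p (Icc 0 (a + b)) := fun x hx => (hp x hx).continuousWithinAt
    have hs₁ : Icc 0 a ⊆ Icc 0 (a + b) := Icc_subset_Icc le_rfl (by linarith)
    have hm₂ : MapsTo (fun x => x + a) (Icc 0 b) (Icc 0 (a + b)) :=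
      fun x hx => ⟨by linarith [hx.1], by linarith [hx.2]⟩
    have q₁ := h₁.parts p p' (fun x hx => (hp x (hs₁ hx)).mono hs₁) (hp'.mono hs₁)
    have q₂ := h₂.parts (fun x => p (x + a)) (fun x => p' (x + a)) (fun x hx => by
      have h2 := (hp (x + a) (hm₂ hx)).scomp x ((hasDerivAt_id x).add_const a).hasDerivWithinAt hm₂
      simpa [Function.comp_def] using h2) (hp'.comp (by fun_prop) hm₂)
    have r₁ := (integral_concat ha hb (f := fun x => p x * _root_.concat a g₁ g₂ x)
      (f₁ := fun x => p x * g₁ x)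
      (f₂ := fun x => p (x + a) * g₂ x) (fun x hx => by rw [concat_of_le _ _ hx.2])
      (fun x hx => by rw [concat_of_gt hx, sub_add_cancel])
      (h₁.int.continuousOn_mul (by rw [uIcc_of_le ha]; exact hpc.mono hs₁))
      (h₂.int.continuousOn_mul (by
        rw [uIcc_of_le hb]; exact hpc.comp (by fun_prop) hm₂))).2
    have r₂ := (integral_concat ha hb (f := fun x => p' x * _root_.concat a w₁ w₂ x)
      (f₁ := fun x => p' x * w₁ x)
      (f₂ := fun x => p' (x + a) * w₂ x) (fun x hx => by rw [concat_of_le _ _ hx.2])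
      (fun x hx => by rw [concat_of_gt hx, sub_add_cancel])
      ((h₁.intervalIntegrable_fun ha).continuousOn_mul (by
        rw [uIcc_of_le ha]; exact hp'.mono hs₁))
      ((h₂.intervalIntegrable_fun hb).continuousOn_mul (by
        rw [uIcc_of_le hb]; exact hp'.comp (by fun_prop) hm₂))).2
    rw [r₁, r₂, q₁, q₂, concat_of_le _ _ ha, concat_of_ge h (by linarith : a ≤ a + b), zero_add, h,
      add_sub_cancel_left, add_comm b a]
    ring

theorem edgeForm_concat {a b : ℝ} (ha : 0 ≤ a) (hb : 0 ≤ b) {w₁ g₁ w₂ g₂ : ℝ → ℝ} (k : ℝ)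
    (h₁ : IsTest a w₁ g₁) (h₂ : IsTest b w₂ g₂) :
    edgeForm k (a + b) (concat a w₁ w₂) (concat a g₁ g₂) =
      edgeForm k a w₁ g₁ + edgeForm k b w₂ g₂ :=
  (integral_concat ha hb (fun x hx => by rw [concat_of_le _ _ hx.2, concat_of_le _ _ hx.2])
    (fun x hx => by rw [concat_of_gt hx, concat_of_gt hx])
    (h₁.intervalIntegrable_form ha k) (h₂.intervalIntegrable_form hb k)).2

theorem isTest_sin {ℓ : ℝ} (hℓ : 0 ≤ ℓ) (k a c : ℝ) :
    IsTest ℓ (fun x => c * Real.sin (k * x + a)) (fun x => c * k * Real.cos (k * x + a)) :=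
  isTest_of_hasDerivWithinAt hℓ (fun x _ => by
    have h := (((((hasDerivAt_id x).const_mul k).add_const a).sin).const_mul c).hasDerivWithinAt
      (s := Icc 0 ℓ)
    refine h.congr_deriv ?_
    simp only [id, mul_one]
    ring) (by fun_prop)

/-- Since `w'' = -k² w`, the integrand `(w')² - k² w²` is the derivative of `w w'`. -/
theorem edgeForm_sin (ℓ k a c : ℝ) :
    edgeForm k ℓ (fun x => c * Real.sin (k * x + a)) (fun x => c * k * Real.cos (k * x + a)) =
      c ^ 2 * k * (Real.sin (k * ℓ + a) * Real.cos (k * ℓ + a) - Real.sin a * Real.cos a) := by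
  unfold edgeForm
  rw [intervalIntegral.integral_eq_sub_of_hasDerivAt
    (f := fun x => c ^ 2 * k * (Real.sin (k * x + a) * Real.cos (k * x + a)))]
  · simp only [mul_zero, zero_add]; ring
  · intro x _
    have h0 := (((hasDerivAt_id x).const_mul k).add_const a)
    refine ((h0.sin.mul h0.cos).const_mul (c ^ 2 * k)).congr_deriv ?_
    simp only [id, mul_one]
    ring
  · exact (by fun_prop : Continuous _).intervalIntegrable _ _

/-- Test functions on an edge along which the phase grows from `a` to `q π + b`: there are `q` free
parameters besides the value at the far end. -/
theorem exists_edge_family {k : ℝ} (hk : 0 < k) (q : ℕ) :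
    ∀ ℓ a b : ℝ, 0 ≤ ℓ → 0 ≤ a → a < Real.pi → 0 ≤ b → b < Real.pi →
    a + k * ℓ = q * Real.pi + b →
    ∃ w g : ((Fin q → ℝ) × ℝ) →ₗ[ℝ] (ℝ → ℝ),
      (∀ c, IsTest ℓ (w c) (g c)) ∧ (∀ c, w c ℓ = if b = 0 then 0 else c.2) ∧
      (a = 0 → ∀ c, w c 0 = 0) ∧
      (∀ c, edgeForm k ℓ (w c) (g c) + k * Real.cot a * w c 0 ^ 2 ≤ k * Real.cot b * w c ℓ ^ 2) ∧
      (∀ c, c.2 = 0 → (∀ x ∈ Icc 0 ℓ, w c x = 0) → c = 0) := by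
  induction q with
  | zero =>
    intro ℓ a b hℓ ha hapi hb hbpi hab
    have hb' : k * ℓ + a = b := by simp at hab; linarith
    have hsb : b ≠ 0 → Real.sin b ≠ 0 := fun h =>
      (Real.sin_pos_of_pos_of_lt_pi (lt_of_le_of_ne hb (Ne.symm h)) hbpi).ne'
    have hsa : Real.sin a = 0 → a = 0 := fun h => by
      by_contra h0
      exact (Real.sin_pos_of_pos_of_lt_pi (lt_of_le_of_ne ha (Ne.symm h0)) hapi).ne' h
    -- For `q = 0` there is one sine arc, scaled to take the value `c.2` at the far end. If `b = 0`,
    -- division by zero makes it vanish, and `cot 0 = 0` by the same convention.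
    refine ⟨⟨⟨fun c x => c.2 / Real.sin b * Real.sin (k * x + a), ?_⟩, ?_⟩,
      ⟨⟨fun c x => c.2 / Real.sin b * k * Real.cos (k * x + a), ?_⟩, ?_⟩,
      fun c => isTest_sin hℓ k a _, fun c => ?_, fun h0 c => ?_, fun c => ?_, fun c hc _ => ?_⟩
    · intro c d; ext x; simp; ring
    · intro r c; ext x; simp; ring
    · intro c d; ext x; simp; ring
    · intro r c; ext x; simp; ring
    · simp only [LinearMap.coe_mk, AddHom.coe_mk, hb']
      split_ifs with h
      · simp [h]
      · rw [div_mul_cancel₀ _ (hsb h)]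
    · simp [h0]
    · simp only [LinearMap.coe_mk, AddHom.coe_mk]
      rw [edgeForm_sin, hb', mul_zero, zero_add, Real.cot_eq_cos_div_sin, Real.cot_eq_cos_div_sin]
      refine le_of_eq ?_
      by_cases h1 : b = 0
      · simp [h1]
      have := hsb h1
      by_cases h2 : Real.sin a = 0
      · rw [h2]
        field_simp
        ring
      · field_simp
        ring
    · exact Prod.ext (Subsingleton.elim _ _) hc
  | succ q ih =>
    intro ℓ a b hℓ ha hapi hb hbpi hab
    have hpi := Real.pi_pos
    push_cast at hab
    -- The interval is cut at the first zero `ℓ₁` of `sin (k x + a)` to the right of the start. The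
    -- arc before it gets its own amplitude `c.1 0`, and the rest starts again with phase `0`.
    obtain ⟨ℓ₁, hℓ₁⟩ : ∃ ℓ₁, k * ℓ₁ + a = Real.pi :=
      ⟨(Real.pi - a) / k, by field_simp; ring⟩
    obtain ⟨ℓ₂, rfl⟩ : ∃ ℓ₂, ℓ = ℓ₁ + ℓ₂ := ⟨ℓ - ℓ₁, by ring⟩
    have h₁ : 0 < ℓ₁ := by
      by_contra! h
      nlinarith
    have hkl : 0 + k * ℓ₂ = q * Real.pi + b := by linarith
    have h₂ : 0 ≤ ℓ₂ := by
      by_contra! h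
      have : (0 : ℝ) ≤ q * Real.pi := by positivity
      nlinarith
    obtain ⟨w, g, hwg, hend, hstart, hform, hinj⟩ := ih ℓ₂ 0 b h₂ le_rfl hpi hb hbpi hkl
    let m : ((Fin (q + 1) → ℝ) × ℝ) →ₗ[ℝ] ((Fin q → ℝ) × ℝ) :=
      (LinearMap.funLeft ℝ ℝ Fin.succ).prodMap LinearMap.id
    have hmatch : ∀ c : (Fin (q + 1) → ℝ) × ℝ,
        (fun x => c.1 0 * Real.sin (k * x + a)) ℓ₁ = w (m c) 0 := fun c => by
      beta_reduce
      rw [hℓ₁, Real.sin_pi, mul_zero, hstart rfl]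
    have hge : ∀ c x, ℓ₁ ≤ x → concat ℓ₁ (fun x => c.1 0 * Real.sin (k * x + a)) (w (m c)) x =
        w (m c) (x - ℓ₁) := fun c x hx =>
      concat_of_ge (w₁ := fun x => c.1 0 * Real.sin (k * x + a)) (hmatch c) hx
    refine ⟨⟨⟨fun c => concat ℓ₁ (fun x => c.1 0 * Real.sin (k * x + a)) (w (m c)), ?_⟩, ?_⟩,
      ⟨⟨fun c => concat ℓ₁ (fun x => c.1 0 * k * Real.cos (k * x + a)) (g (m c)), ?_⟩, ?_⟩,
      fun c => (isTest_sin h₁.le k a _).concat h₁.le h₂ (hwg _) (hmatch c),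
      fun c => ?_, fun h0 c => ?_, fun c => ?_, fun c hc hz => ?_⟩
    · intro c d; ext x
      simp only [concat, map_add, Pi.add_apply, Prod.fst_add]
      split_ifs <;> ring
    · intro r c; ext x
      simp only [concat, map_smul, Pi.smul_apply, Prod.smul_fst, smul_eq_mul, RingHom.id_apply]
      split_ifs <;> ring
    · intro c d; ext x
      simp only [concat, map_add, Pi.add_apply, Prod.fst_add]
      split_ifs <;> ring
    · intro r c; ext x
      simp only [concat, map_smul, Pi.smul_apply, Prod.smul_fst, smul_eq_mul, RingHom.id_apply]
      split_ifs <;> ring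
    · simp only [LinearMap.coe_mk, AddHom.coe_mk]
      rw [hge c _ (by linarith), add_sub_cancel_left, hend]
      rfl
    · simp only [LinearMap.coe_mk, AddHom.coe_mk]
      rw [concat_of_le _ _ h₁.le]
      simp [h0]
    · simp only [LinearMap.coe_mk, AddHom.coe_mk]
      rw [edgeForm_concat h₁.le h₂ k (isTest_sin h₁.le k a _) (hwg _), edgeForm_sin,
        hge c (ℓ₁ + ℓ₂) (by linarith), add_sub_cancel_left, concat_of_le _ _ h₁.le]
      have h3 := hform (m c)
      rw [hstart rfl] at h3
      rw [hℓ₁, Real.sin_pi, mul_zero, zero_add, Real.cot_eq_cos_div_sin a]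
      by_cases h2 : Real.sin a = 0
      · rw [h2]
        simp only [zero_mul, mul_zero, sub_zero, div_zero]
        linarith
      · have : c.1 0 ^ 2 * k * (0 - Real.sin a * Real.cos a) +
          k * (Real.cos a / Real.sin a) * (c.1 0 * Real.sin a) ^ 2 = 0 := by
          field_simp
          ring
        linarith
    · simp only [LinearMap.coe_mk, AddHom.coe_mk] at hz
      have hc0 : c.1 0 = 0 := by
        -- At the midpoint of the first arc the sine is nonzero, so a vanishing function has
        -- vanishing first amplitude.
        have hx : k * (ℓ₁ / 2) + a = (Real.pi + a) / 2 := by linarith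
        have h4 := hz (ℓ₁ / 2) ⟨by linarith, by linarith⟩
        rw [concat_of_le _ _ (by linarith), hx] at h4
        have h5 : 0 < Real.sin ((Real.pi + a) / 2) :=
          Real.sin_pos_of_pos_of_lt_pi (by linarith) (by linarith)
        exact (mul_eq_zero.mp h4).resolve_right h5.ne'
      have h6 := hinj (m c) hc fun x hx => by
        have h7 := hz (ℓ₁ + x) ⟨by linarith [hx.1], by linarith [hx.2]⟩
        rwa [hge c _ (by linarith [hx.1]), add_sub_cancel_left] at h7
      refine Prod.ext (funext fun i => ?_) hc
      refine Fin.cases hc0 (fun j => ?_) i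
      exact congrFun (congrArg Prod.fst h6) j

end

section

open Set MeasureTheory

/-! ### Spaces of test functions on a metric graph -/

namespace MetricGraph

variable {V E : Type*}

/-- A linear family of test functions on the edges in `R`, with values `φ` at the vertices, on which
the form `∑ ∫ (w')² - k² w² + k ∑ cot (α v) φ(v)²` is nonpositive.  The phase `α v = 0` stands for a
Dirichlet condition at `v`. -/
structure TestFamily [Fintype V] (G : MetricGraph V E) (k : ℝ) (R : Finset E) (α : V → ℝ)
    (ι : Type) where
  φ : (ι → ℝ) →ₗ[ℝ] (V → ℝ)
  w : (ι → ℝ) →ₗ[ℝ] (E → ℝ → ℝ)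
  g : (ι → ℝ) →ₗ[ℝ] (E → ℝ → ℝ)
  isTest : ∀ c, ∀ e ∈ R, IsTest (G.length e) (w c e) (g c e)
  src_eq : ∀ c, ∀ e ∈ R, w c e 0 = φ c (G.src e)
  tgt_eq : ∀ c, ∀ e ∈ R, w c e (G.length e) = φ c (G.tgt e)
  dirichlet : ∀ c v, α v = 0 → φ c v = 0
  form_nonpos : ∀ c, ∑ e ∈ R, edgeForm k (G.length e) (w c e) (g c e) +
    ∑ v, k * Real.cot (α v) * φ c v ^ 2 ≤ 0
  inj : ∀ c, φ c = 0 → (∀ e ∈ R, ∀ x ∈ Icc 0 (G.length e), w c e x = 0) → c = 0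

/-- There is an `n`-dimensional family of test functions. -/
def HasTestSpace [Fintype V] (G : MetricGraph V E) (k : ℝ) (R : Finset E) (α : V → ℝ)
    (n : ℕ) : Prop :=
  ∃ (ι : Type) (_ : Fintype ι), Fintype.card ι = n ∧ Nonempty (TestFamily G k R α ι)

/-- The edge `e` joins `v` and `w`. -/
def Joins (G : MetricGraph V E) (e : E) (v w : V) : Prop :=
  (G.src e = v ∧ G.tgt e = w) ∨ (G.src e = w ∧ G.tgt e = v)

theorem hasTestSpace_empty [Fintype V] (G : MetricGraph V E) (k : ℝ) :
    HasTestSpace G k ∅ 0 0 :=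
  ⟨Empty, inferInstance, rfl, ⟨⟨0, 0, 0, by simp, by simp, by simp, by simp, by simp,
    fun _ _ _ => Subsingleton.elim _ _⟩⟩⟩

/-- Imposing additional Dirichlet conditions shrinks the test space. -/
theorem HasTestSpace.of_dirichlet [Fintype V] {G : MetricGraph V E} {k : ℝ} {R : Finset E}
    {α α' : V → ℝ} {n : ℕ} (h : HasTestSpace G k R α' n) (hα : ∀ v, α' v = 0 ∨ α' v = α v) :
    HasTestSpace G k R α n := by
  obtain ⟨ι, _, hn, ⟨T⟩⟩ := h
  refine ⟨ι, _, hn, ⟨⟨T.φ, T.w, T.g, T.isTest, T.src_eq, T.tgt_eq, fun c v hv => ?_,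
    fun c => ?_, T.inj⟩⟩⟩
  · rcases hα v with h | h
    · exact T.dirichlet c v h
    · exact T.dirichlet c v (h.trans hv)
  · refine le_trans (le_of_eq ?_) (T.form_nonpos c)
    congr 1
    refine Finset.sum_congr rfl fun v _ => ?_
    rcases hα v with h | h
    · simp [T.dirichlet c v h]
    · rw [h]

/-- This lets the phase travel from `v` to `w` whichever way the edge is parametrised; against the
parametrisation the family is reflected. Here `β c` is the value at `v`. Restricting to `c.2 = 0`
when `b = 0` makes `c.2` the value at `w` in every case. -/
theorem exists_oriented_edge_family (G : MetricGraph V E) {e : E} {v w : V} (he : G.Joins e v w)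
    {k : ℝ} (hk : 0 < k) {q : ℕ} {a b : ℝ} (ha : 0 ≤ a) (hapi : a < Real.pi) (hb : 0 ≤ b)
    (hbpi : b < Real.pi) (hab : a + k * G.length e = q * Real.pi + b) :
    ∃ (W D : ((Fin q → ℝ) × ℝ) →ₗ[ℝ] (ℝ → ℝ)) (β : ((Fin q → ℝ) × ℝ) →ₗ[ℝ] ℝ),
      (∀ c, IsTest (G.length e) (W c) (D c)) ∧
      ((G.src e = v ∧ G.tgt e = w ∧
          ∀ c, (b = 0 → c.2 = 0) → W c 0 = β c ∧ W c (G.length e) = c.2) ∨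
        (G.src e = w ∧ G.tgt e = v ∧
          ∀ c, (b = 0 → c.2 = 0) → W c 0 = c.2 ∧ W c (G.length e) = β c)) ∧
      (a = 0 → ∀ c, β c = 0) ∧
      (∀ c, (b = 0 → c.2 = 0) →
        edgeForm k (G.length e) (W c) (D c) + k * Real.cot a * β c ^ 2 ≤
          k * Real.cot b * c.2 ^ 2) ∧
      (∀ c, c.2 = 0 → (∀ x ∈ Icc 0 (G.length e), W c x = 0) → c = 0) := by
  obtain ⟨W, D, hW, hend, hstart, hform, hinj⟩ :=
    exists_edge_family hk q (G.length e) a b (G.length_pos e).le ha hapi hb hbpi hab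
  have hend' : ∀ c : (Fin q → ℝ) × ℝ, (b = 0 → c.2 = 0) → W c (G.length e) = c.2 :=
    fun c hc => by
      rw [hend]
      split_ifs with h
      · exact (hc h).symm
      · rfl
  rcases he with ⟨h1, h2⟩ | ⟨h1, h2⟩
  · refine ⟨W, D, (LinearMap.proj 0) ∘ₗ W, hW, Or.inl ⟨h1, h2, fun c hc => ⟨rfl, hend' c hc⟩⟩,
      hstart, fun c hc => ?_, hinj⟩
    have := hform c
    rw [hend' c hc] at this
    exact this
  · refine ⟨(LinearMap.funLeft ℝ ℝ (fun x => G.length e - x)) ∘ₗ W,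
      -((LinearMap.funLeft ℝ ℝ (fun x => G.length e - x)) ∘ₗ D), (LinearMap.proj 0) ∘ₗ W,
      fun c => (hW c).reflect, Or.inr ⟨h1, h2, fun c hc => ⟨?_, ?_⟩⟩,
      hstart, fun c hc => ?_, fun c hc hz => hinj c hc fun x hx => ?_⟩
    · simpa [LinearMap.funLeft] using hend' c hc
    · simp [LinearMap.funLeft]
    · have := hform c
      rw [hend' c hc, ← edgeForm_reflect] at this
      exact this
    · have := hz (G.length e - x) ⟨by linarith [hx.2], by linarith [hx.1]⟩
      simpa [LinearMap.funLeft] using this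

/-- Eliminating an edge `e` from `v` to `w`: the phase at `v` is transported along `e` and merged
into the phase at `w`. -/
theorem HasTestSpace.insert_edge [Fintype V] [DecidableEq E] {G : MetricGraph V E} {k : ℝ}
    (hk : 0 < k) {R : Finset E} {α α' : V → ℝ} {n q : ℕ} {e : E} (heR : e ∉ R) {v w : V}
    (he : G.Joins e v w)
    (hv : α v = 0 ∨ (v ≠ w ∧ ∀ e' ∈ R, G.src e' ≠ v ∧ G.tgt e' ≠ v)) {b : ℝ} (ha : 0 ≤ α v)
    (hapi : α v < Real.pi) (hb : 0 ≤ b) (hbpi : b < Real.pi)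
    (hab : α v + k * G.length e = q * Real.pi + b)
    (hα'v : α' v = 0)
    (hα'w : α' w = 0 ∨ (b ≠ 0 ∧ α w ≠ 0 ∧ Real.cot b + Real.cot (α w) ≤ Real.cot (α' w)))
    (hα' : ∀ u, u ≠ v → u ≠ w → α' u = α u) (h : HasTestSpace G k R α' n) :
    HasTestSpace G k (insert e R) α (n + q) := by
  classical
  obtain ⟨ι, _, hn, ⟨T⟩⟩ := h
  obtain ⟨W, D, β, hW, hends, hβ0, hform, hinj⟩ :=
    exists_oriented_edge_family G he hk ha hapi hb hbpi hab
  let l : (ι ⊕ Fin q → ℝ) →ₗ[ℝ] (ι → ℝ) := LinearMap.funLeft ℝ ℝ Sum.inl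
  let r : (ι ⊕ Fin q → ℝ) →ₗ[ℝ] (Fin q → ℝ) := LinearMap.funLeft ℝ ℝ Sum.inr
  -- Gluing: the value of the edge family at `w` is prescribed by the old family, so the edge
  -- contributes only its `q` amplitudes as new parameters. Its other end then determines the new
  -- value at `v`.
  let d : (ι ⊕ Fin q → ℝ) →ₗ[ℝ] ((Fin q → ℝ) × ℝ) := r.prod (LinearMap.proj w ∘ₗ T.φ ∘ₗ l)
  let φ : (ι ⊕ Fin q → ℝ) →ₗ[ℝ] (V → ℝ) :=
    LinearMap.pi fun u => if u = v then β ∘ₗ d else LinearMap.proj u ∘ₗ T.φ ∘ₗ l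
  let wn : (ι ⊕ Fin q → ℝ) →ₗ[ℝ] (E → ℝ → ℝ) :=
    LinearMap.pi fun e' => if e' = e then W ∘ₗ d else LinearMap.proj e' ∘ₗ T.w ∘ₗ l
  let gn : (ι ⊕ Fin q → ℝ) →ₗ[ℝ] (E → ℝ → ℝ) :=
    LinearMap.pi fun e' => if e' = e then D ∘ₗ d else LinearMap.proj e' ∘ₗ T.g ∘ₗ l
  have hd2 : ∀ c, (d c).2 = T.φ (l c) w := fun c => rfl
  have hφv : ∀ c, φ c v = β (d c) := fun c => by simp [φ]
  have hφu : ∀ c u, u ≠ v → φ c u = T.φ (l c) u := fun c u hu => by simp [φ, hu]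
  have hwe : ∀ c, wn c e = W (d c) := fun c => by simp [wn]
  have hge : ∀ c, gn c e = D (d c) := fun c => by simp [gn]
  have hwR : ∀ c, ∀ e' ∈ R, wn c e' = T.w (l c) e' := fun c e' he' => by
    simp [wn, show e' ≠ e from fun h => heR (h ▸ he')]
  have hgR : ∀ c, ∀ e' ∈ R, gn c e' = T.g (l c) e' := fun c e' he' => by
    simp [gn, show e' ≠ e from fun h => heR (h ▸ he')]
  have hTv : ∀ c, T.φ c v = 0 := fun c => T.dirichlet c v hα'v
  have hφ0 : α v = 0 → ∀ c u, φ c u = T.φ (l c) u := fun h0 c u => by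
    by_cases hu : u = v
    · rw [hu, hφv, hβ0 h0, hTv]
    · exact hφu c u hu
  have hφw : ∀ c, φ c w = T.φ (l c) w := fun c => by
    by_cases hw : w = v
    · rcases hv with h0 | h0
      · exact hφ0 h0 c w
      · exact absurd hw.symm h0.1
    · exact hφu c w hw
  have hφR : ∀ c, ∀ e' ∈ R, φ c (G.src e') = T.φ (l c) (G.src e') ∧
      φ c (G.tgt e') = T.φ (l c) (G.tgt e') := fun c e' he' => by
    rcases hv with h0 | h0
    · exact ⟨hφ0 h0 c _, hφ0 h0 c _⟩
    · exact ⟨hφu c _ (h0.2 e' he').1, hφu c _ (h0.2 e' he').2⟩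
  have hb0 : ∀ c, b = 0 → (d c).2 = 0 := fun c hb0 => by
    rw [hd2]
    refine T.dirichlet _ w (hα'w.resolve_right fun h => h.1 hb0)
  refine ⟨ι ⊕ Fin q, inferInstance, by simp [hn], ⟨⟨φ, wn, gn, fun c e' he' => ?_,
    fun c e' he' => ?_, fun c e' he' => ?_, fun c u hu => ?_, fun c => ?_, fun c hc hz => ?_⟩⟩⟩
  · rcases Finset.mem_insert.mp he' with rfl | he'
    · rw [hwe, hge]; exact hW _
    · rw [hwR c e' he', hgR c e' he']; exact T.isTest _ e' he'
  · rcases Finset.mem_insert.mp he' with rfl | he'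
    · rw [hwe]
      rcases hends with ⟨h1, h2, h3⟩ | ⟨h1, h2, h3⟩
      · rw [h1, hφv, (h3 _ (hb0 c)).1]
      · rw [h1, hφw, (h3 _ (hb0 c)).1, hd2]
    · rw [hwR c e' he', (hφR c e' he').1]; exact T.src_eq _ e' he'
  · rcases Finset.mem_insert.mp he' with rfl | he'
    · rw [hwe]
      rcases hends with ⟨h1, h2, h3⟩ | ⟨h1, h2, h3⟩
      · rw [h2, hφw, (h3 _ (hb0 c)).2, hd2]
      · rw [h2, hφv, (h3 _ (hb0 c)).2]
    · rw [hwR c e' he', (hφR c e' he').2]; exact T.tgt_eq _ e' he'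
  · by_cases huv : u = v
    · subst huv
      rw [hφv, hβ0 hu]
    · rw [hφu c u huv]
      refine T.dirichlet _ u ?_
      by_cases huw : u = w
      · subst huw
        exact hα'w.resolve_right fun h => h.2.1 hu
      · rw [hα' u huv huw, hu]
  -- Vertex by vertex the new form exceeds the old one by at most `k cot (α v) β²` at `v` and `-k
  -- cot b φ(w)²` at `w`. These two terms are exactly what the form of the added edge compensates.
  · have hterm : ∀ u, k * Real.cot (α u) * φ c u ^ 2 ≤ k * Real.cot (α' u) * T.φ (l c) u ^ 2 +
        (if u = v then k * Real.cot (α v) * β (d c) ^ 2 else 0) +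
        (if u = w then -(k * Real.cot b * T.φ (l c) w ^ 2) else 0) := fun u => by
      by_cases huv : u = v
      · subst huv
        rw [hφv, hTv, if_pos rfl]
        split_ifs with huw
        · rw [← huw, hTv]; simp
        · simp
      · rw [hφu c u huv, if_neg huv]
        split_ifs with huw
        · subst huw
          rcases hα'w with h0 | h0
          · rw [T.dirichlet _ u h0]; simp
          · have := mul_le_mul_of_nonneg_left h0.2.2
              (mul_nonneg hk.le (sq_nonneg (T.φ (l c) u)))
            linarith
        · rw [hα' u huv huw]; simp
    have hsum := Finset.sum_le_sum fun u (_ : u ∈ Finset.univ) => hterm u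
    rw [Finset.sum_add_distrib, Finset.sum_add_distrib, Finset.sum_ite_eq' Finset.univ v,
      Finset.sum_ite_eq' Finset.univ w, if_pos (Finset.mem_univ _),
      if_pos (Finset.mem_univ _)] at hsum
    have hR : ∑ e' ∈ R, edgeForm k (G.length e') (wn c e') (gn c e') =
        ∑ e' ∈ R, edgeForm k (G.length e') (T.w (l c) e') (T.g (l c) e') :=
      Finset.sum_congr rfl fun e' he' => by rw [hwR c e' he', hgR c e' he']
    rw [Finset.sum_insert heR, hwe, hge, hR]
    have h1 := hform (d c) (hb0 c)
    rw [hd2] at h1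
    linarith [T.form_nonpos (l c)]
  · have hl : l c = 0 := by
      refine T.inj _ (funext fun u => ?_) fun e' he' x hx => ?_
      · by_cases huv : u = v
        · rw [huv, hTv]; rfl
        · rw [← hφu c u huv, hc]
      · rw [← hwR c e' he']
        exact hz e' (Finset.mem_insert_of_mem he') x hx
    have hd : d c = 0 := by
      refine hinj _ (by rw [hd2, hl]; simp) fun x hx => ?_
      rw [← hwe]
      exact hz e (Finset.mem_insert_self _ _) x hx
    funext i
    rcases i with i | i
    · exact congrFun hl i
    · exact congrFun (congrArg Prod.fst hd) i

end MetricGraph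

end

section

open Set MeasureTheory

/-! ### Phases, spanning trees and the dimension of the test space -/

theorem exists_phase {x : ℝ} (hx : 0 ≤ x) :
    ∃ (q : ℕ) (b : ℝ), 0 ≤ b ∧ b < Real.pi ∧ x = q * Real.pi + b := by
  have hpi := Real.pi_pos
  refine ⟨⌊x / Real.pi⌋₊, x - ⌊x / Real.pi⌋₊ * Real.pi, ?_, ?_, by ring⟩
  · have := Nat.floor_le (div_nonneg hx hpi.le)
    rw [le_div_iff₀ hpi] at this
    linarith
  · have := Nat.lt_floor_add_one (x / Real.pi)
    rw [div_lt_iff₀ hpi] at this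
    linarith

/-- Two phases meeting at a vertex merge with a loss of at most `π`. -/
theorem exists_merged_phase {a b : ℝ} (hapi : a < Real.pi) (hbpi : b < Real.pi) :
    ∃ γ, 0 ≤ γ ∧ γ < Real.pi ∧
      (γ = 0 ∨ (b ≠ 0 ∧ a ≠ 0 ∧ Real.cot b + Real.cot a ≤ Real.cot γ)) ∧ b + a - Real.pi ≤ γ := by
  have hpi := Real.pi_pos
  -- If `a + b ≤ π`, a Dirichlet condition already loses no more than `π`; otherwise the phase `a +
  -- b - π` works.
  rcases le_or_gt (a + b) Real.pi with h | h
  · exact ⟨0, le_rfl, hpi, Or.inl rfl, by linarith⟩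
  have ha0 : 0 < a := by linarith
  have hb0 : 0 < b := by linarith
  refine ⟨a + b - Real.pi, by linarith, by linarith, Or.inr ⟨hb0.ne', ha0.ne', ?_⟩, by linarith⟩
  have hsa := Real.sin_pos_of_pos_of_lt_pi ha0 hapi
  have hsb := Real.sin_pos_of_pos_of_lt_pi hb0 hbpi
  have hS := Real.sin_pos_of_pos_of_lt_pi (show 0 < a + b - Real.pi by linarith) (by linarith)
  -- After clearing denominators the claim is `cos (a + b) sin a sin b ≤ sin² (a + b)`. Substituting
  -- `sin a sin b = cos a cos b - cos (a + b)` turns it into this bound.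
  have hC : Real.cos a * Real.cos b * Real.cos (a + b) ≤ 1 := by
    refine (le_abs_self _).trans ?_
    rw [abs_mul, abs_mul]
    exact mul_le_one₀ (mul_le_one₀ (Real.abs_cos_le_one _) (abs_nonneg _) (Real.abs_cos_le_one _))
      (abs_nonneg _) (Real.abs_cos_le_one _)
  have hsq := Real.sin_sq_add_cos_sq (a + b)
  rw [Real.cot_eq_cos_div_sin, Real.cot_eq_cos_div_sin, Real.cot_eq_cos_div_sin,
    div_add_div _ _ hsb.ne' hsa.ne', div_le_div_iff₀ (by positivity) hS, Real.sin_sub_pi,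
    Real.cos_sub_pi]
  have h1 : Real.cos b * Real.sin a + Real.sin b * Real.cos a = Real.sin (a + b) := by
    rw [Real.sin_add]; ring
  have h2 := Real.cos_add a b
  have h3 : Real.sin b * Real.sin a = Real.cos a * Real.cos b - Real.cos (a + b) := by
    rw [h2]; ring
  rw [h1, h3]
  linarith

namespace MetricGraph

variable {V E : Type*}

/-- The weight of a vertex in the phase count: `π` if it is still flagged as untouched, and its
phase otherwise. -/
noncomputable def phaseWeight [DecidableEq V] (α : V → ℝ) (F : Finset V) (v : V) : ℝ :=
  if v ∈ F then Real.pi else α v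

/-- The accounting for one edge: the phase at `v` and `k ℓ(e)` amount to `q π + b`, and merging `b`
into `w` loses at most `π`. The alternative on `v` says that either the value at `v` is already `0`,
so remaining edges there (or a loop) do not matter, or `e` is the last edge at `v` and not a loop.
The set `F` holds the Neumann vertices that no phase has reached. -/
theorem exists_absorb [Fintype V] [DecidableEq V] [DecidableEq E] (G : MetricGraph V E) {k : ℝ}
    (hk : 0 < k) {R : Finset E} {e : E} (heR : e ∉ R) {v w : V} (he : G.Joins e v w) {α : V → ℝ}
    {F : Finset V} (hv : α v = 0 ∨ (v ≠ w ∧ ∀ e' ∈ R, G.src e' ≠ v ∧ G.tgt e' ≠ v))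
    (hα : ∀ u, 0 ≤ α u ∧ α u < Real.pi) (hF : ∀ u ∈ F, α u = Real.pi / 2) (hvF : v ∉ F) :
    ∃ (q : ℕ) (α' : V → ℝ), (∀ u, 0 ≤ α' u ∧ α' u < Real.pi) ∧ α' v = 0 ∧
      (α w = 0 → α' w = 0) ∧ (∀ u, u ≠ v → u ≠ w → α' u = α u) ∧
      (∀ n, HasTestSpace G k R α' n → HasTestSpace G k (insert e R) α (n + q)) ∧
      ∑ u, phaseWeight α F u + k * G.length e ≤
        ∑ u, phaseWeight α' (F.erase w) u + Real.pi * (q + 1) := by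
  have hpi := Real.pi_pos
  obtain ⟨q, b, hb, hbpi, hab⟩ := exists_phase
    (add_nonneg (hα v).1 (mul_nonneg hk.le (G.length_pos e).le))
  obtain ⟨γ, hγ, hγpi, hγ', hγw⟩ : ∃ γ, 0 ≤ γ ∧ γ < Real.pi ∧
      (γ = 0 ∨ (b ≠ 0 ∧ α w ≠ 0 ∧ Real.cot b + Real.cot (α w) ≤ Real.cot γ)) ∧
      phaseWeight α F w ≤ γ + (Real.pi - b) := by
    by_cases hwF : w ∈ F
    · refine ⟨b, hb, hbpi, ?_, by simp [phaseWeight, hwF]⟩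
      by_cases hb0 : b = 0
      · exact Or.inl hb0
      · refine Or.inr ⟨hb0, ?_, ?_⟩
        · rw [hF w hwF]; positivity
        · rw [hF w hwF, Real.cot_eq_cos_div_sin (Real.pi / 2), Real.cos_pi_div_two]; simp
    · obtain ⟨γ, h1, h2, h3, h4⟩ := exists_merged_phase (hα w).2 hbpi
      exact ⟨γ, h1, h2, h3, by simp only [phaseWeight, if_neg hwF]; linarith⟩
  have hw0 : α w = 0 → γ = 0 := fun h0 => hγ'.resolve_right fun h => h.2.1 h0
  let α' : V → ℝ := Function.update (Function.update α v 0) w γ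
  have hα'w : α' w = γ := by simp [α']
  have hα'v : α' v = 0 := by
    by_cases hvw : v = w
    · subst hvw
      rw [hα'w]
      exact hw0 (hv.resolve_right fun h => h.1 rfl)
    · simp [α', hvw]
  have hα'u : ∀ u, u ≠ v → u ≠ w → α' u = α u := fun u huv huw => by simp [α', huv, huw]
  refine ⟨q, α', fun u => ?_, hα'v, fun h => hα'w.trans (hw0 h), hα'u, fun n hn =>
    hn.insert_edge hk heR he hv (hα v).1 (hα v).2 hb hbpi hab hα'v (by rwa [hα'w]) hα'u, ?_⟩
  · by_cases huw : u = w
    · rw [huw, hα'w]; exact ⟨hγ, hγpi⟩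
    · by_cases huv : u = v
      · rw [huv, hα'v]; exact ⟨le_rfl, hpi⟩
      · rw [hα'u u huv huw]; exact hα u
  · have hterm : ∀ u, phaseWeight α F u ≤ phaseWeight α' (F.erase w) u +
        (if u = v then α v else 0) + (if u = w then Real.pi - b else 0) := fun u => by
      by_cases huv : u = v
      · subst huv
        have h1 : phaseWeight α F u = α u := if_neg hvF
        have h2 : phaseWeight α' (F.erase w) u = 0 := by
          rw [phaseWeight, if_neg fun h => hvF (Finset.mem_of_mem_erase h), hα'v]
        rw [h1, h2, if_pos rfl]
        split_ifs <;> linarith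
      · rw [if_neg huv]
        split_ifs with huw
        · subst huw
          have h2 : phaseWeight α' (F.erase u) u = γ := by
            rw [phaseWeight, if_neg (Finset.notMem_erase u F), hα'w]
          linarith
        · simp [phaseWeight, huw, hα'u u huv huw]
    have hsum := Finset.sum_le_sum fun u (_ : u ∈ Finset.univ) => hterm u
    rw [Finset.sum_add_distrib, Finset.sum_add_distrib, Finset.sum_ite_eq' Finset.univ v,
      Finset.sum_ite_eq' Finset.univ w, if_pos (Finset.mem_univ _),
      if_pos (Finset.mem_univ _)] at hsum
    linarith

/-- A spanning tree with root `r`, in terms of the parent `par v` of each vertex `v ≠ r`, the edge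
`p v` that leads there, and a height function `d`. -/
structure IsTree (G : MetricGraph V E) (r : V) (p : V → E) (par : V → V) (d : V → ℕ) : Prop where
  joins : ∀ v, v ≠ r → G.Joins (p v) v (par v)
  lt : ∀ v, v ≠ r → d (par v) < d v

/-! ### Spanning trees as parent maps -/

theorem Joins.symm {G : MetricGraph V E} {e : E} {v w : V} (h : G.Joins e v w) : G.Joins e w v :=
  Or.symm h

theorem reflTransGen_joins_symm {G : MetricGraph V E} {S : Set E} {a b : V}
    (h : Relation.ReflTransGen (fun u v => ∃ e ∈ S, G.Joins e u v) a b) :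
    Relation.ReflTransGen (fun u v => ∃ e ∈ S, G.Joins e u v) b a := by
  induction h with
  | refl => exact Relation.ReflTransGen.refl
  | tail _ hbc ih =>
    obtain ⟨e, he, hj⟩ := hbc
    exact Relation.ReflTransGen.head ⟨e, he, hj.symm⟩ ih

theorem Joins.eq_or_eq {G : MetricGraph V E} {e : E} {u v w : V} (h : G.Joins e v w)
    (hu : G.src e = u ∨ G.tgt e = u) : u = v ∨ u = w := by
  rcases h with ⟨h1, h2⟩ | ⟨h1, h2⟩ <;> rcases hu with rfl | rfl <;> simp [h1, h2]

theorem Joins.incident {G : MetricGraph V E} {e : E} {v w : V} (h : G.Joins e v w) :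
    G.src e = v ∨ G.tgt e = v := by
  rcases h with h | h
  · exact Or.inl h.1
  · exact Or.inr h.2

/-- If two vertices had the same parent edge, each would be the parent of the other, and both
heights would be smaller than the other. -/
theorem IsTree.injOn {G : MetricGraph V E} {r : V} {p : V → E} {par : V → V} {d : V → ℕ}
    (h : G.IsTree r p par d) : InjOn p {v | v ≠ r} := fun u hu v hv huv => by
  by_contra hne
  have h1 := (h.joins u hu).eq_or_eq (huv ▸ (h.joins v hv).incident)
  have h2 := (h.joins v hv).eq_or_eq (huv ▸ (h.joins u hu).incident)
  have h3 := h1.resolve_left fun h => hne h.symm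
  have h4 := h2.resolve_left hne
  have h5 := h.lt u hu
  have h6 := h.lt v hv
  rw [← h3] at h5
  rw [← h4] at h6
  omega

theorem exists_isTree [Nonempty E] (G : MetricGraph V E) {S : Set E} {r : V}
    (h : ∀ v : V, Relation.ReflTransGen (fun u v => ∃ e ∈ S, G.Joins e u v) r v) :
    ∃ (p : V → E) (par : V → V) (d : V → ℕ), G.IsTree r p par d ∧ ∀ v, v ≠ r → p v ∈ S := by
  classical
  -- `B n` is the set of ends of walks of length `n` from `r` with edges in `S`. The height is the
  -- graph distance, and the parent is the previous vertex on a shortest walk.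
  let B : ℕ → Set V := fun n => Nat.rec {r} (fun _ s => {v | ∃ u ∈ s, ∃ e ∈ S, G.Joins e u v}) n
  have hB : ∀ n, B (n + 1) = {v | ∃ u ∈ B n, ∃ e ∈ S, G.Joins e u v} := fun n => rfl
  have hex : ∀ v, ∃ n, v ∈ B n := fun v => by
    induction h v with
    | refl => exact ⟨0, rfl⟩
    | tail _ hbc ih =>
      obtain ⟨n, hn⟩ := ih
      exact ⟨n + 1, _, hn, hbc⟩
  let d : V → ℕ := fun v => sInf {n | v ∈ B n}
  have hstep : ∀ v, v ≠ r → ∃ u, ∃ e ∈ S, G.Joins e v u ∧ d u < d v :=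
    fun v hv => by
      have h1 : v ∈ B (d v) := Nat.sInf_mem (hex v)
      obtain ⟨n, hn⟩ : ∃ n, d v = n + 1 := by
        refine Nat.exists_eq_succ_of_ne_zero fun h0 => hv ?_
        rw [h0] at h1
        exact h1
      rw [hn, hB] at h1
      obtain ⟨u, hu, e, he, hj⟩ := h1
      exact ⟨u, e, he, hj.symm, by
        rw [hn]
        exact Nat.lt_succ_of_le (Nat.sInf_le hu)⟩
  choose! u e he hj hlt using hstep
  exact ⟨e, u, d, ⟨hj, hlt⟩, he⟩

/-- Eliminating the edges of a tree, farthest vertices first. -/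
theorem exists_testSpace_tree [Fintype V] [DecidableEq V] [DecidableEq E] {G : MetricGraph V E}
    {k : ℝ} (hk : 0 < k) {r : V} {p : V → E} {par : V → V} {d : V → ℕ} (h : G.IsTree r p par d)
    (S : Finset V) : r ∉ S → (∀ v ∈ S, par v = r ∨ par v ∈ S) → ∀ (α : V → ℝ) (F : Finset V),
    (∀ u, 0 ≤ α u ∧ α u < Real.pi) → (∀ u ∉ S, α u = 0) →
    (∀ u ∈ F, α u = Real.pi / 2 ∧ ∃ v ∈ S, par v = u) →
    ∃ N : ℕ, HasTestSpace G k (S.image p) α N ∧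
      ∑ u, phaseWeight α F u + k * ∑ v ∈ S, G.length (p v) ≤ Real.pi * (N + S.card) := by
  have hpi := Real.pi_pos
  induction S using Finset.induction_on_max_value d with
  | empty =>
    intro _ _ α F _ hα0 hF
    have hα : α = 0 := funext fun u => hα0 u (Finset.notMem_empty u)
    have hF0 : F = ∅ := Finset.eq_empty_of_forall_notMem fun u hu => by simpa using (hF u hu).2
    subst hα hF0
    exact ⟨0, by simpa using hasTestSpace_empty G k, by simp [phaseWeight]⟩
  | insert v S hvS hmax ih =>
    intro hr hclosed α F hα hα0 hF
    rw [Finset.mem_insert, not_or] at hr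
    have hvr : v ≠ r := Ne.symm hr.1
    have hne : ∀ u, u ∈ insert v S → u ≠ r := fun u hu => by
      rcases Finset.mem_insert.mp hu with rfl | hu
      · exact hvr
      · exact fun h => hr.2 (h ▸ hu)
    -- `v` has no children left
    have hchild : ∀ u ∈ insert v S, par u ≠ v := fun u hu huv => by
      have h1 := h.lt u (hne u hu)
      rw [huv] at h1
      rcases Finset.mem_insert.mp hu with rfl | hu
      · omega
      · have := hmax u hu
        omega
    have hvw : v ≠ par v := (hchild v (Finset.mem_insert_self _ _)).symm
    -- An untouched vertex still has a child in the set, but `v` has none: its phase may be used at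
    -- its true value instead of the weight `π`.
    have hvF : v ∉ F := fun hv => by
      obtain ⟨u, hu, huv⟩ := (hF v hv).2
      exact hchild u hu huv
    have hpS : ∀ e ∈ S.image p, G.src e ≠ v ∧ G.tgt e ≠ v := fun e he => by
      obtain ⟨u, hu, rfl⟩ := Finset.mem_image.mp he
      by_contra hcon
      have huS : u ∈ insert v S := Finset.mem_insert_of_mem hu
      rcases (h.joins u (hne u huS)).eq_or_eq (u := v) (by tauto) with h1 | h1
      · exact hvS (h1 ▸ hu)
      · exact hchild u huS h1.symm
    have hpv : p v ∉ S.image p := fun hmem => by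
      have h1 := hpS _ hmem
      rcases (h.joins v hvr).incident with h2 | h2
      · exact h1.1 h2
      · exact h1.2 h2
    obtain ⟨q, α', hα', hα'v, hα'w, hα'u, hspace, hsum⟩ := exists_absorb G hk hpv (h.joins v hvr)
      (Or.inr ⟨hvw, hpS⟩) hα (fun u hu => (hF u hu).1) hvF
    obtain ⟨N, hN, hbound⟩ := ih hr.2
      (fun u hu => (hclosed u (Finset.mem_insert_of_mem hu)).imp_right fun h1 =>
        (Finset.mem_insert.mp h1).resolve_left (hchild u (Finset.mem_insert_of_mem hu)))
      α' (F.erase (par v)) hα' (fun u hu => by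
        by_cases huv : u = v
        · rw [huv, hα'v]
        have hu' : u ∉ insert v S := by simp [huv, hu]
        by_cases huw : u = par v
        · rw [huw]
          exact hα'w (huw ▸ hα0 u hu')
        · rw [hα'u u huv huw, hα0 u hu'])
      (fun u hu => by
        rw [Finset.mem_erase] at hu
        obtain ⟨h1, y, hy, hyu⟩ := hF u hu.2
        refine ⟨?_, y, ?_, hyu⟩
        · rw [hα'u u (fun h => hvF (h ▸ hu.2)) hu.1, h1]
        · refine (Finset.mem_insert.mp hy).resolve_left fun h2 => hu.1 ?_
          rw [← hyu, h2])
    refine ⟨N + q, by rw [Finset.image_insert]; exact hspace N hN, ?_⟩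
    rw [Finset.sum_insert hvS, Finset.card_insert_of_notMem hvS]
    push_cast
    linarith

/-- Eliminating first edges outside of a spanning tree, then the tree. -/
theorem exists_testSpace_insert [Fintype V] [DecidableEq V] [DecidableEq E] {G : MetricGraph V E}
    {k : ℝ} (hk : 0 < k) {r : V} {p : V → E} {par : V → V} {d : V → ℕ} (h : G.IsTree r p par d)
    (A : Finset E) : Disjoint A ((Finset.univ.erase r).image p) → ∀ (α : V → ℝ) (F : Finset V),
    (∀ u, 0 ≤ α u ∧ α u < Real.pi) → α r = 0 →
    (∀ u ∈ F, α u = Real.pi / 2 ∧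
      ((∃ v, v ≠ r ∧ par v = u) ∨ ∃ e ∈ A, G.src e = u ∨ G.tgt e = u)) →
    ∃ N : ℕ, HasTestSpace G k (A ∪ (Finset.univ.erase r).image p) α N ∧
      ∑ u, phaseWeight α F u + k * ∑ e ∈ A ∪ (Finset.univ.erase r).image p, G.length e ≤
        Real.pi * (N + (Fintype.card V - 1) + 2 * A.card) := by
  have hpi := Real.pi_pos
  induction A using Finset.induction_on with
  | empty =>
    intro _ α F hα hαr hF
    obtain ⟨N, hN, hbound⟩ := exists_testSpace_tree hk h (Finset.univ.erase r)
      (Finset.notMem_erase _ _) (fun v _ => by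
        rw [Finset.mem_erase]
        simp only [Finset.mem_univ, and_true]
        exact em _) α F hα (fun u hu => by
        have : u = r := by simpa using hu
        rw [this, hαr]) (fun u hu => ⟨(hF u hu).1, by simpa using (hF u hu).2⟩)
    refine ⟨N, by simpa using hN, ?_⟩
    rw [Finset.empty_union, Finset.sum_image fun u hu v hv huv =>
      h.injOn (by simpa using hu) (by simpa using hv) huv]
    have hcard : ((Finset.univ.erase r).card : ℝ) = Fintype.card V - 1 := by
      rw [Finset.card_erase_of_mem (Finset.mem_univ r), Finset.card_univ,
        Nat.cast_sub (Fintype.card_pos_iff.mpr ⟨r⟩)]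
      simp
    rw [hcard] at hbound
    simpa using hbound
  | insert e A heA ih =>
    intro hdisj α F hα hαr hF
    rw [Finset.disjoint_insert_left] at hdisj
    have heR : e ∉ A ∪ (Finset.univ.erase r).image p := by
      rw [Finset.mem_union, not_or]
      exact ⟨heA, hdisj.1⟩
    let v := G.src e
    let α₁ : V → ℝ := Function.update α v 0
    have hα₁v : α₁ v = 0 := by simp [α₁]
    have hα₁u : ∀ u, u ≠ v → α₁ u = α u := fun u hu => by simp [α₁, hu]
    have hα₁r : α₁ r = 0 := by
      by_cases hrv : r = v
      · rw [hrv, hα₁v]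
      · rw [hα₁u r hrv, hαr]
    -- The first of the two losses of an edge off the tree: a Dirichlet condition at one end costs
    -- at most `π`. The second is the merger at the other end.
    have hweight : ∑ u, phaseWeight α F u ≤ ∑ u, phaseWeight α₁ (F.erase v) u + Real.pi := by
      have hterm : ∀ u, phaseWeight α F u ≤
          phaseWeight α₁ (F.erase v) u + if u = v then Real.pi else 0 := fun u => by
        by_cases huv : u = v
        · rw [if_pos huv, huv]
          simp only [phaseWeight, Finset.notMem_erase, if_false, hα₁v, zero_add]
          split_ifs
          · exact le_rfl
          · exact (hα v).2.le
        · simp [phaseWeight, huv, hα₁u u huv]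
      have hsum := Finset.sum_le_sum fun u (_ : u ∈ Finset.univ) => hterm u
      rwa [Finset.sum_add_distrib, Finset.sum_ite_eq' Finset.univ v,
        if_pos (Finset.mem_univ _)] at hsum
    obtain ⟨q, α', hα', hα'v, hα'w, hα'u, hspace, hsum⟩ := exists_absorb G hk (α := α₁)
      (F := F.erase v) (v := v) (w := G.tgt e) heR (Or.inl ⟨rfl, rfl⟩) (Or.inl hα₁v)
      (fun u => by
        by_cases huv : u = v
        · rw [huv, hα₁v]; exact ⟨le_rfl, hpi⟩
        · rw [hα₁u u huv]; exact hα u)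
      (fun u hu => by
        rw [Finset.mem_erase] at hu
        rw [hα₁u u hu.1, (hF u hu.2).1])
      (Finset.notMem_erase _ _)
    obtain ⟨N, hN, hbound⟩ := ih hdisj.2 α' ((F.erase v).erase (G.tgt e)) hα' (by
        by_cases hrv : r = v
        · rw [hrv, hα'v]
        · by_cases hrw : r = G.tgt e
          · rw [hrw]
            exact hα'w (hrw ▸ hα₁r)
          · rw [hα'u r hrv hrw, hα₁r]) (fun u hu => by
        rw [Finset.mem_erase, Finset.mem_erase] at hu
        obtain ⟨h1, h2⟩ := hF u hu.2.2
        refine ⟨by rw [hα'u u hu.2.1 hu.1, hα₁u u hu.2.1, h1], h2.imp_right ?_⟩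
        rintro ⟨e', he', hinc⟩
        refine ⟨e', (Finset.mem_insert.mp he').resolve_left ?_, hinc⟩
        rintro rfl
        rcases hinc with h3 | h3
        · exact hu.2.1 h3.symm
        · exact hu.1 h3.symm)
    refine ⟨N + q, ?_, ?_⟩
    · rw [Finset.insert_union]
      refine (hspace N hN).of_dirichlet fun u => ?_
      by_cases huv : u = v
      · rw [huv]; exact Or.inl hα₁v
      · exact Or.inr (hα₁u u huv)
    · rw [Finset.insert_union, Finset.sum_insert heR, Finset.card_insert_of_notMem heA]
      push_cast
      linarith

/-! ### Pendant vertices, the Betti number and edges off the tree -/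

theorem exists_incident_ne_of_not_isPendant [DecidableEq V] [Fintype E] {G : MetricGraph V E}
    {v w : V} {e : E} (he : G.Joins e v w) (hvw : v ≠ w) (hv : ¬ G.IsPendant v) :
    ∃ e', e' ≠ e ∧ (G.src e' = v ∨ G.tgt e' = v) := by
  classical
  by_contra! hcon
  refine hv ?_
  unfold IsPendant degree
  rcases he with ⟨h1, h2⟩ | ⟨h1, h2⟩
  · have h3 : (Finset.univ.filter fun e => G.src e = v) = {e} := by
      ext e'
      simp only [Finset.mem_filter, Finset.mem_univ, true_and, Finset.mem_singleton]
      refine ⟨fun h => ?_, fun h => h ▸ h1⟩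
      by_contra hne
      exact (hcon e' hne).1 h
    have h4 : (Finset.univ.filter fun e => G.tgt e = v) = ∅ := by
      ext e'
      simp only [Finset.mem_filter, Finset.mem_univ, true_and, Finset.notMem_empty, iff_false]
      intro h
      by_cases hne : e' = e
      · exact hvw (by rw [← h, hne, h2])
      · exact (hcon e' hne).2 h
    rw [h3, h4]; rfl
  · have h3 : (Finset.univ.filter fun e => G.tgt e = v) = {e} := by
      ext e'
      simp only [Finset.mem_filter, Finset.mem_univ, true_and, Finset.mem_singleton]
      refine ⟨fun h => ?_, fun h => h ▸ h2⟩
      by_contra hne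
      exact (hcon e' hne).2 h
    have h4 : (Finset.univ.filter fun e => G.src e = v) = ∅ := by
      ext e'
      simp only [Finset.mem_filter, Finset.mem_univ, true_and, Finset.notMem_empty, iff_false]
      intro h
      by_cases hne : e' = e
      · exact hvw (by rw [← h, hne, h1])
      · exact (hcon e' hne).1 h
    rw [h3, h4]; rfl

/-- A vertex other than the root that is not pendant has a child or is incident to an edge outside
of the tree. -/
theorem IsTree.child_or_incident [Fintype V] [DecidableEq V] [Fintype E] [DecidableEq E]
    {G : MetricGraph V E} {r : V} {p : V → E} {par : V → V} {d : V → ℕ} (h : G.IsTree r p par d)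
    {v : V} (hvr : v ≠ r) (hv : ¬ G.IsPendant v) :
    (∃ u, u ≠ r ∧ par u = v) ∨
      ∃ e ∈ ((Finset.univ.erase r).image p)ᶜ, G.src e = v ∨ G.tgt e = v := by
  have hlt := h.lt v hvr
  obtain ⟨e, hne, hinc⟩ := exists_incident_ne_of_not_isPendant (h.joins v hvr)
    (fun h' => by rw [← h'] at hlt; omega) hv
  by_cases he : e ∈ (Finset.univ.erase r).image p
  · obtain ⟨u, hu, rfl⟩ := Finset.mem_image.mp he
    have hur : u ≠ r := Finset.ne_of_mem_erase hu
    refine Or.inl ⟨u, hur, ?_⟩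
    exact (((h.joins u hur).eq_or_eq hinc).resolve_left fun h' => hne (by rw [h'])).symm
  · exact Or.inr ⟨e, Finset.mem_compl.mpr he, hinc⟩

theorem IsTree.card_image [Fintype V] [DecidableEq V] [DecidableEq E]
    {G : MetricGraph V E} {r : V} {p : V → E} {par : V → V} {d : V → ℕ} (h : G.IsTree r p par d) :
    (((Finset.univ.erase r).image p).card : ℤ) = Fintype.card V - 1 := by
  rw [Finset.card_image_of_injOn fun u hu v hv huv =>
      h.injOn (by simpa using hu) (by simpa using hv) huv,
    Finset.card_erase_of_mem (Finset.mem_univ r), Finset.card_univ,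
    Nat.cast_sub (Fintype.card_pos_iff.mpr ⟨r⟩)]
  simp

theorem IsTree.card_compl [Fintype V] [DecidableEq V] [Fintype E] [DecidableEq E]
    {G : MetricGraph V E} {r : V} {p : V → E} {par : V → V} {d : V → ℕ} (h : G.IsTree r p par d) :
    ((((Finset.univ.erase r).image p)ᶜ).card : ℤ) = G.betti := by
  have h1 := h.card_image
  have h2 := Finset.card_add_card_compl ((Finset.univ.erase r).image p)
  unfold betti
  omega

theorem Connected.exists_isTree [Nonempty E] {G : MetricGraph V E} (hG : G.Connected) (r : V) :
    ∃ (p : V → E) (par : V → V) (d : V → ℕ), G.IsTree r p par d := by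
  obtain ⟨p, par, d, h, -⟩ := MetricGraph.exists_isTree G (S := Set.univ) (r := r) fun v =>
    Relation.ReflTransGen.mono (fun a b ⟨e, he⟩ => ⟨e, mem_univ _, he⟩) _ _ (hG.2 r v)
  exact ⟨p, par, d, h⟩

theorem Connected.exists_incident [Nonempty E] {G : MetricGraph V E} (hG : G.Connected) (v : V) :
    ∃ e, G.src e = v ∨ G.tgt e = v := by
  obtain ⟨e⟩ := ‹Nonempty E›
  rcases Relation.ReflTransGen.cases_head (hG.2 v (G.src e)) with h | ⟨w, ⟨e', he'⟩, -⟩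
  · exact ⟨e, Or.inl h.symm⟩
  · exact ⟨e', Joins.incident he'⟩

theorem Connected.betti_nonneg [Fintype V] [Fintype E] [Nonempty E] {G : MetricGraph V E}
    (hG : G.Connected) : 0 ≤ G.betti := by
  classical
  obtain ⟨r⟩ := hG.1
  obtain ⟨p, par, d, h⟩ := hG.exists_isTree r
  rw [← h.card_compl]
  positivity

/-- The phases of the vertex conditions: Dirichlet on `D` and Neumann elsewhere. -/
noncomputable def vertexPhase [DecidableEq V] (D : Finset V) (v : V) : ℝ :=
  if v ∈ D then 0 else Real.pi / 2

theorem vertexPhase_bounds [DecidableEq V] (D : Finset V) (v : V) :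
    0 ≤ vertexPhase D v ∧ vertexPhase D v < Real.pi := by
  have hpi := Real.pi_pos
  unfold vertexPhase
  split_ifs <;> constructor <;> linarith

theorem sum_phaseWeight_vertexPhase [Fintype V] [DecidableEq V] (D : Finset V) :
    ∑ v, phaseWeight (vertexPhase D) Dᶜ v = Real.pi * (Fintype.card V - D.card) := by
  have h1 : ∀ v, phaseWeight (vertexPhase D) Dᶜ v = if v ∈ Dᶜ then Real.pi else 0 := fun v => by
    by_cases hv : v ∈ D <;> simp [phaseWeight, vertexPhase, hv]
  simp only [h1]
  rw [Finset.sum_ite_mem, Finset.univ_inter, Finset.sum_const, nsmul_eq_mul,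
    Finset.card_compl, Nat.cast_sub (Finset.card_le_univ D)]
  ring

/-- The root is taken in `D`, so its phase is `0` from the start. With initial weight `π * (n -
|D|)`, the count reads `π * (n - |D|) + k L ≤ π * (N + n - 1 + 2 * β)`. -/
theorem exists_testSpace_of_nonempty [Fintype V] [DecidableEq V] [Fintype E] [Nonempty E]
    {G : MetricGraph V E} (hG : G.Connected) {D : Finset V} (hD : D.Nonempty)
    (hpend : ∀ v, G.IsPendant v → v ∈ D) {k : ℝ} (hk : 0 < k) :
    ∃ N : ℕ, HasTestSpace G k Finset.univ (vertexPhase D) N ∧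
      k * G.totalLength ≤ Real.pi * (N - 1 + 2 * G.betti + D.card) := by
  classical
  obtain ⟨r, hr⟩ := hD
  obtain ⟨p, par, d, h⟩ := hG.exists_isTree r
  obtain ⟨N, hN, hbound⟩ := exists_testSpace_insert hk h ((Finset.univ.erase r).image p)ᶜ
    disjoint_compl_left (vertexPhase D) Dᶜ (vertexPhase_bounds D) (by simp [vertexPhase, hr])
    (fun u hu => by
      rw [Finset.mem_compl] at hu
      exact ⟨by simp [vertexPhase, hu], h.child_or_incident (fun hur => hu (hur ▸ hr))
        fun hp => hu (hpend u hp)⟩)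
  have hcard : (((((Finset.univ.erase r).image p)ᶜ).card : ℤ) : ℝ) = (G.betti : ℝ) := by
    rw [h.card_compl]
  have hunion : ((Finset.univ.erase r).image p)ᶜ ∪ (Finset.univ.erase r).image p =
      Finset.univ := by
    rw [Finset.union_comm, Finset.union_compl]
  rw [hunion] at hN hbound
  refine ⟨N, hN, ?_⟩
  rw [sum_phaseWeight_vertexPhase] at hbound
  push_cast at hcard
  rw [hcard] at hbound
  unfold totalLength
  linarith

theorem IsTree.reflTransGen [Fintype V] [DecidableEq V] [DecidableEq E]
    {G : MetricGraph V E} {r : V} {p : V → E} {par : V → V} {d : V → ℕ} (h : G.IsTree r p par d)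
    (v : V) : Relation.ReflTransGen
      (fun a b => ∃ e ∈ ((Finset.univ.erase r).image p : Set E), G.Joins e a b) v r := by
  induction hn : d v using Nat.strong_induction_on generalizing v with
  | _ n ih =>
    by_cases hv : v = r
    · rw [hv]
    · refine Relation.ReflTransGen.head ⟨p v, ?_, h.joins v hv⟩
        (ih (d (par v)) (hn ▸ h.lt v hv) (par v) rfl)
      simpa using ⟨v, hv, rfl⟩

/-- A graph without pendant vertices has an edge outside of a spanning tree of it. -/
theorem IsTree.exists_notMem [Fintype V] [DecidableEq V] [Fintype E] [DecidableEq E] [Nonempty E]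
    {G : MetricGraph V E} {r : V} {p : V → E} {par : V → V} {d : V → ℕ} (h : G.IsTree r p par d)
    (hpend : ∀ v, ¬ G.IsPendant v) : ∃ e, e ∉ (Finset.univ.erase r).image p := by
  by_contra! hall
  obtain ⟨e⟩ := ‹Nonempty E›
  obtain ⟨v₀, hv₀, -⟩ := Finset.mem_image.mp (hall e)
  obtain ⟨v, hv, hmax⟩ := Finset.exists_max_image (Finset.univ.erase r) d ⟨v₀, hv₀⟩
  -- A vertex of maximal height has no child, so if the tree contained all edges this vertex would
  -- be pendant.
  rcases h.child_or_incident (Finset.ne_of_mem_erase hv) (hpend v) with ⟨u, hu, huv⟩ | ⟨e, he, -⟩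
  · have h1 := h.lt u hu
    have h2 := hmax u (by simpa using hu)
    rw [huv] at h1
    omega
  · exact Finset.mem_compl.mp he (hall e)

/-- Imposing a Dirichlet condition at one vertex `r` and using the count for `D = {r}` would lose
one dimension too many. Choosing `r` at an end of an edge `e₀` off the tree recovers it: `e₀` is
removed first, with the vanishing phase at `r` already paid for, so only `β - 1` edges cost `2 π`.
-/
theorem exists_testSpace_of_empty [Fintype V] [DecidableEq V] [Fintype E] [Nonempty E]
    {G : MetricGraph V E} (hG : G.Connected) (hpend : ∀ v, ¬ G.IsPendant v) {k : ℝ} (hk : 0 < k) :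
    ∃ N : ℕ, HasTestSpace G k Finset.univ (vertexPhase ∅) N ∧
      k * G.totalLength ≤ Real.pi * (N - 1 + 2 * G.betti) := by
  classical
  -- re-root the graph without an edge `e₀` of a cycle at an end of `e₀`
  obtain ⟨r₀⟩ := hG.1
  obtain ⟨p₀, par₀, d₀, h₀⟩ := hG.exists_isTree r₀
  obtain ⟨e₀, he₀⟩ := h₀.exists_notMem hpend
  set r := G.src e₀ with hr
  -- The first tree already connects all vertices without `e₀`, so a new spanning tree rooted at `r`
  -- can avoid `e₀`.
  have hto : ∀ v, Relation.ReflTransGen (fun a b => ∃ e ∈ ({e₀}ᶜ : Set E), G.Joins e a b) v r₀ :=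
    fun v => Relation.ReflTransGen.mono (fun a b ⟨e, he, hj⟩ =>
      ⟨e, fun hee => he₀ (by rw [← mem_singleton_iff.mp hee]; exact_mod_cast he), hj⟩)
      _ _ (h₀.reflTransGen v)
  obtain ⟨p, par, d, h, hp⟩ := exists_isTree G (S := {e₀}ᶜ) (r := r) fun v =>
    (hto r).trans (reflTransGen_joins_symm (hto v))
  have he₀T : e₀ ∉ (Finset.univ.erase r).image p := fun hmem => by
    obtain ⟨v, hv, hpv⟩ := Finset.mem_image.mp hmem
    exact hp v (Finset.ne_of_mem_erase hv) hpv
  set T := (Finset.univ.erase r).image p with hT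
  have he₀R : e₀ ∉ (Tᶜ.erase e₀) ∪ T := by simp [he₀T]
  have hαr : vertexPhase {r} r = 0 := by simp [vertexPhase]
  obtain ⟨q, α', hα', hα'v, hα'w, hα'u, hspace, hsum⟩ := exists_absorb G hk
    (α := vertexPhase {r}) (F := ({r} : Finset V)ᶜ) he₀R (Or.inl ⟨hr.symm, rfl⟩)
    (Or.inl hαr) (vertexPhase_bounds _)
    (fun u hu => by
      have hur : u ≠ r := by simpa using hu
      simp [vertexPhase, hur]) (by simp)
  obtain ⟨N, hN, hbound⟩ := exists_testSpace_insert hk h (Tᶜ.erase e₀)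
    (Finset.disjoint_of_subset_left (Finset.erase_subset _ _) disjoint_compl_left) α'
    (({r} : Finset V)ᶜ.erase (G.tgt e₀)) hα' hα'v (fun u hu => by
      have hu' : u ≠ G.tgt e₀ ∧ u ≠ r := by simpa using hu
      refine ⟨by rw [hα'u u hu'.2 hu'.1]; simp [vertexPhase, hu'.2], ?_⟩
      refine (h.child_or_incident hu'.2 (hpend u)).imp_right ?_
      rintro ⟨e, he, hinc⟩
      refine ⟨e, Finset.mem_erase.mpr ⟨?_, he⟩, hinc⟩
      rintro rfl
      rcases hinc with h3 | h3
      · exact hu'.2 h3.symm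
      · exact hu'.1 h3.symm)
  have hunion : insert e₀ (Tᶜ.erase e₀ ∪ T) = Finset.univ := by
    rw [← Finset.insert_union, Finset.insert_erase (Finset.mem_compl.mpr he₀T), Finset.union_comm,
      Finset.union_compl]
  have hspace' := hspace N hN
  rw [hunion] at hspace'
  refine ⟨N + q, hspace'.of_dirichlet fun u => ?_, ?_⟩
  · by_cases hu : u = r
    · exact Or.inl (hu ▸ hαr)
    · exact Or.inr (by simp [vertexPhase, hu])
  · have hlen : G.totalLength = G.length e₀ + ∑ e ∈ Tᶜ.erase e₀ ∪ T, G.length e := by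
      rw [totalLength, ← hunion, Finset.sum_insert he₀R]
    have hcard : (((Tᶜ.erase e₀).card : ℤ) : ℝ) = (G.betti : ℝ) - 1 := by
      have h1 := h.card_compl
      have h2 := Finset.card_erase_add_one (Finset.mem_compl.mpr he₀T)
      rw [← hT] at h1
      have h3 : (((Tᶜ.erase e₀).card : ℤ)) = G.betti - 1 := by omega
      rw [h3]
      push_cast
      ring
    push_cast at hcard
    rw [sum_phaseWeight_vertexPhase, Finset.card_singleton] at hsum
    rw [hcard] at hbound
    rw [hlen]
    push_cast at hsum ⊢
    linarith

end MetricGraph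

end

section

open Set MeasureTheory

/-! ### The equation `-u'' + u = f` on a metric graph -/

namespace MetricGraph

variable {V E : Type*} [DecidableEq V] [Fintype E]

/-- `u` solves `-u'' + u = f` with Dirichlet conditions on `D` and Neumann conditions elsewhere;
`g` is the derivative of `u` and `φ` its restriction to the vertices. -/
structure Solves (G : MetricGraph V E) (D : Finset V) (f u g : E → ℝ → ℝ) (φ : V → ℝ) : Prop where
  src_eq : ∀ e, u e 0 = φ (G.src e)
  tgt_eq : ∀ e, u e (G.length e) = φ (G.tgt e)
  deriv : ∀ e, ∀ x ∈ Icc 0 (G.length e), HasDerivWithinAt (u e) (g e x) (Icc 0 (G.length e)) x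
  deriv₂ : ∀ e, ∀ x ∈ Icc 0 (G.length e),
    HasDerivWithinAt (g e) (u e x - f e x) (Icc 0 (G.length e)) x
  dirichlet : ∀ v ∈ D, φ v = 0
  neumann : ∀ v, v ∉ D →
    (∑ e with G.src e = v, g e 0) + (∑ e with G.tgt e = v, -g e (G.length e)) = 0

variable {G : MetricGraph V E} {D : Finset V} {f u g f' u' g' : E → ℝ → ℝ} {φ φ' : V → ℝ}

theorem Solves.add (h : G.Solves D f u g φ) (h' : G.Solves D f' u' g' φ') :
    G.Solves D (f + f') (u + u') (g + g') (φ + φ') where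
  src_eq e := by simp [h.src_eq, h'.src_eq]
  tgt_eq e := by simp [h.tgt_eq, h'.tgt_eq]
  deriv e x hx := (h.deriv e x hx).add (h'.deriv e x hx)
  deriv₂ e x hx := ((h.deriv₂ e x hx).add (h'.deriv₂ e x hx)).congr_deriv (by
    simp only [Pi.add_apply]; ring)
  dirichlet v hv := by simp [h.dirichlet v hv, h'.dirichlet v hv]
  neumann v hv := by
    have h1 := h.neumann v hv
    have h2 := h'.neumann v hv
    simp only [Pi.add_apply, Finset.sum_add_distrib, Finset.sum_neg_distrib] at h1 h2 ⊢
    linarith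

theorem Solves.smul (h : G.Solves D f u g φ) (c : ℝ) :
    G.Solves D (c • f) (c • u) (c • g) (c • φ) where
  src_eq e := by simp [h.src_eq]
  tgt_eq e := by simp [h.tgt_eq]
  deriv e x hx := (h.deriv e x hx).const_smul c
  deriv₂ e x hx := ((h.deriv₂ e x hx).const_smul c).congr_deriv (by
    simp only [Pi.smul_apply, smul_eq_mul]; ring)
  dirichlet v hv := by simp [h.dirichlet v hv]
  neumann v hv := by
    have h1 := h.neumann v hv
    simp only [Pi.smul_apply, smul_eq_mul, ← mul_neg, ← Finset.mul_sum, ← mul_add]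
    rw [h1, mul_zero]

theorem Solves.congr (h : G.Solves D f u g φ)
    (hf : ∀ e, ∀ x ∈ Icc 0 (G.length e), f' e x = f e x)
    (hu : ∀ e, ∀ x ∈ Icc 0 (G.length e), u' e x = u e x) : G.Solves D f' u' g φ where
  src_eq e := by rw [hu e 0 ⟨le_rfl, (G.length_pos e).le⟩, h.src_eq]
  tgt_eq e := by rw [hu e _ ⟨(G.length_pos e).le, le_rfl⟩, h.tgt_eq]
  deriv e x hx := (h.deriv e x hx).congr (hu e) (hu e x hx)
  deriv₂ e x hx := by rw [hf e x hx, hu e x hx]; exact h.deriv₂ e x hx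
  dirichlet := h.dirichlet
  neumann := h.neumann

theorem Solves.isTest (h : G.Solves D f u g φ) (e : E) : IsTest (G.length e) (u e) (g e) :=
  isTest_of_hasDerivWithinAt (G.length_pos e).le (h.deriv e)
    fun x hx => (h.deriv₂ e x hx).continuousWithinAt

/-- The Kirchhoff conditions make the boundary terms of an integration by parts cancel. -/
theorem Solves.sum_boundary_eq_zero [Fintype V] (h : G.Solves D f u g φ) {ψ : V → ℝ}
    (hψ : ∀ v ∈ D, ψ v = 0) :
    ∑ e, (g e (G.length e) * ψ (G.tgt e) - g e 0 * ψ (G.src e)) = 0 := by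
  have h1 : ∑ v, ψ v * ((∑ e with G.src e = v, g e 0) +
      (∑ e with G.tgt e = v, -g e (G.length e))) = 0 := Finset.sum_eq_zero fun v _ => by
    by_cases hv : v ∈ D
    · rw [hψ v hv, zero_mul]
    · rw [h.neumann v hv, mul_zero]
  have h2 : ∑ v, ∑ e with G.src e = v, ψ v * g e 0 = ∑ e, ψ (G.src e) * g e 0 := by
    rw [← Finset.sum_fiberwise Finset.univ G.src]
    refine Finset.sum_congr rfl fun v _ => Finset.sum_congr rfl fun e he => ?_
    rw [(Finset.mem_filter.mp he).2]
  have h3 : ∑ v, ∑ e with G.tgt e = v, ψ v * -g e (G.length e) =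
      ∑ e, ψ (G.tgt e) * -g e (G.length e) := by
    rw [← Finset.sum_fiberwise Finset.univ G.tgt]
    refine Finset.sum_congr rfl fun v _ => Finset.sum_congr rfl fun e he => ?_
    rw [(Finset.mem_filter.mp he).2]
  simp only [mul_add, Finset.mul_sum, Finset.sum_add_distrib, h2, h3] at h1
  rw [Finset.sum_sub_distrib]
  simp only [mul_neg, Finset.sum_neg_distrib] at h1
  simp only [mul_comm (g _ _)]
  linarith

/-- The weak form of the equation. -/
theorem Solves.energy [Fintype V] (h : G.Solves D f u g φ)
    (hf : ∀ e, ContinuousOn (f e) (Icc 0 (G.length e))) {w w' : E → ℝ → ℝ} {ψ : V → ℝ}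
    (hw : ∀ e, IsTest (G.length e) (w e) (w' e)) (hsrc : ∀ e, w e 0 = ψ (G.src e))
    (htgt : ∀ e, w e (G.length e) = ψ (G.tgt e)) (hψ : ∀ v ∈ D, ψ v = 0) :
    ∑ e, ((∫ x in (0 : ℝ)..G.length e, g e x * w' e x) +
      ∫ x in (0 : ℝ)..G.length e, u e x * w e x) =
      ∑ e, ∫ x in (0 : ℝ)..G.length e, f e x * w e x := by
  have hedge : ∀ e, (∫ x in (0 : ℝ)..G.length e, g e x * w' e x) +
      (∫ x in (0 : ℝ)..G.length e, u e x * w e x) =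
      (∫ x in (0 : ℝ)..G.length e, f e x * w e x) +
        (g e (G.length e) * ψ (G.tgt e) - g e 0 * ψ (G.src e)) := fun e => by
    have hu : ContinuousOn (u e) (Icc 0 (G.length e)) := (h.isTest e).cont
    have hwc := (hw e).cont
    have h1 := (hw e).parts (g e) (fun x => u e x - f e x) (h.deriv₂ e) (hu.sub (hf e))
    have huw : IntervalIntegrable (fun x => u e x * w e x) volume 0 (G.length e) := by
      refine ContinuousOn.intervalIntegrable ?_
      rw [uIcc_of_le (G.length_pos e).le]
      exact hu.mul hwc
    have hfw : IntervalIntegrable (fun x => f e x * w e x) volume 0 (G.length e) := by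
      refine ContinuousOn.intervalIntegrable ?_
      rw [uIcc_of_le (G.length_pos e).le]
      exact (hf e).mul hwc
    simp only [sub_mul] at h1
    rw [intervalIntegral.integral_sub huw hfw, hsrc, htgt] at h1
    linarith
  rw [Finset.sum_congr rfl fun e _ => hedge e, Finset.sum_add_distrib, h.sum_boundary_eq_zero hψ,
    add_zero]

/-- Testing the equation with `u` itself gives `∫ (u')² + ∫ u² = 0`. The zeroth-order term yields
uniqueness for the pure Neumann problem as well. -/
theorem Solves.eq_zero [Fintype V] (h : G.Solves D 0 u g φ) :
    ∀ e, ∀ x ∈ Icc 0 (G.length e), u e x = 0 := by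
  have h1 := h.energy (fun e => continuousOn_const) h.isTest h.src_eq h.tgt_eq h.dirichlet
  have hnn : ∀ (p : ℝ → ℝ) e, 0 ≤ ∫ x in (0 : ℝ)..G.length e, p x * p x := fun p e =>
    intervalIntegral.integral_nonneg (G.length_pos e).le fun x _ => mul_self_nonneg _
  simp only [Pi.zero_apply, zero_mul, intervalIntegral.integral_zero, Finset.sum_const_zero] at h1
  intro e x hx
  have h2 := (Finset.sum_eq_zero_iff_of_nonneg fun e _ => add_nonneg (hnn (g e) e)
    (hnn (u e) e)).mp h1 e (Finset.mem_univ e)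
  have h3 : ∫ x in (0 : ℝ)..G.length e, u e x * u e x = 0 := by
    linarith [hnn (g e) e, hnn (u e) e]
  by_contra hx0
  have h4 := intervalIntegral.integral_pos (f := fun x => u e x * u e x) (G.length_pos e)
    ((h.isTest e).cont.mul (h.isTest e).cont) (fun x _ => mul_self_nonneg _)
    ⟨x, hx, mul_self_pos.mpr hx0⟩
  linarith

theorem Solves.unique [Fintype V] (h : G.Solves D f u g φ) (h' : G.Solves D f u' g' φ') :
    ∀ e, ∀ x ∈ Icc 0 (G.length e), u e x = u' e x := fun e x hx => by
  have h1 := h.add (h'.smul (-1))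
  rw [show f + (-1 : ℝ) • f = 0 by simp] at h1
  have := h1.eq_zero e x hx
  simp only [Pi.add_apply, Pi.smul_apply, smul_eq_mul] at this
  linarith

/-! ### Existence of solutions -/

/-- A solution of `S'' = S + f` with vanishing data at `0`, and its derivative. -/
theorem exists_particular_solution {f : ℝ → ℝ} (hf : Continuous f) :
    ∃ S S' : ℝ → ℝ, S 0 = 0 ∧ S' 0 = 0 ∧ (∀ x, HasDerivAt S (S' x) x) ∧
      ∀ x, HasDerivAt S' (S x + f x) x := by
  let P : ℝ → ℝ := fun x => ∫ t in (0 : ℝ)..x, Real.cosh t * f t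
  let Q : ℝ → ℝ := fun x => ∫ t in (0 : ℝ)..x, Real.sinh t * f t
  have hP : ∀ x, HasDerivAt P (Real.cosh x * f x) x := fun x =>
    (Real.continuous_cosh.mul hf).integral_hasStrictDerivAt 0 x |>.hasDerivAt
  have hQ : ∀ x, HasDerivAt Q (Real.sinh x * f x) x := fun x =>
    (Real.continuous_sinh.mul hf).integral_hasStrictDerivAt 0 x |>.hasDerivAt
  refine ⟨fun x => Real.sinh x * P x - Real.cosh x * Q x,
    fun x => Real.cosh x * P x - Real.sinh x * Q x, by simp [P, Q], by simp [P, Q],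
    fun x => ?_, fun x => ?_⟩
  · refine (((Real.hasDerivAt_sinh x).mul (hP x)).sub
      ((Real.hasDerivAt_cosh x).mul (hQ x))).congr_deriv ?_
    ring
  · refine (((Real.hasDerivAt_cosh x).mul (hP x)).sub
      ((Real.hasDerivAt_sinh x).mul (hQ x))).congr_deriv ?_
    have := Real.cosh_sq x
    linear_combination (f x) * this

variable (G D) in
/-- The boundary data of `a cosh + b sinh` on the edges, with values `φ` at the vertices. -/
noncomputable def boundaryMap : ((E → ℝ) × (E → ℝ) × (V → ℝ)) →ₗ[ℝ]
    ((E → ℝ) × (E → ℝ) × (V → ℝ)) where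
  toFun z := (fun e => z.1 e - z.2.2 (G.src e),
    fun e => z.1 e * Real.cosh (G.length e) + z.2.1 e * Real.sinh (G.length e) - z.2.2 (G.tgt e),
    fun v => if v ∈ D then z.2.2 v else (∑ e with G.src e = v, z.2.1 e) +
      ∑ e with G.tgt e = v,
        -(z.1 e * Real.sinh (G.length e) + z.2.1 e * Real.cosh (G.length e)))
  map_add' y z := by
    refine Prod.ext (funext fun e => ?_) (Prod.ext (funext fun e => ?_) (funext fun v => ?_))
    · simp only [Prod.fst_add, Prod.snd_add, Pi.add_apply]; ring
    · simp only [Prod.fst_add, Prod.snd_add, Pi.add_apply]; ring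
    · simp only [Prod.fst_add, Prod.snd_add, Pi.add_apply]
      split_ifs
      · rfl
      · simp only [Finset.sum_neg_distrib, Finset.sum_add_distrib, add_mul]; ring
  map_smul' c z := by
    refine Prod.ext (funext fun e => ?_) (Prod.ext (funext fun e => ?_) (funext fun v => ?_))
    · simp only [Prod.smul_fst, Prod.smul_snd, Pi.smul_apply, smul_eq_mul, RingHom.id_apply]; ring
    · simp only [Prod.smul_fst, Prod.smul_snd, Pi.smul_apply, smul_eq_mul, RingHom.id_apply]; ring
    · simp only [Prod.smul_fst, Prod.smul_snd, Pi.smul_apply, smul_eq_mul, RingHom.id_apply]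
      split_ifs
      · rfl
      · rw [mul_add, Finset.mul_sum, Finset.mul_sum]
        congr 1
        exact Finset.sum_congr rfl fun e _ => by ring

theorem solves_of_boundaryMap_eq {z : (E → ℝ) × (E → ℝ) × (V → ℝ)} {S S' : E → ℝ → ℝ}
    (hS0 : ∀ e, S e 0 = 0) (hS'0 : ∀ e, S' e 0 = 0)
    (hS : ∀ e x, HasDerivAt (S e) (S' e x) x)
    (hS' : ∀ e x, HasDerivAt (S' e) (S e x + f e x) x)
    (hz : boundaryMap G D z = (0, fun e => S e (G.length e),
      fun v => if v ∈ D then 0 else ∑ e with G.tgt e = v, -S' e (G.length e))) :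
    G.Solves D f (fun e x => z.1 e * Real.cosh x + z.2.1 e * Real.sinh x - S e x)
      (fun e x => z.1 e * Real.sinh x + z.2.1 e * Real.cosh x - S' e x) z.2.2 where
  src_eq e := by
    have h := congrFun (congrArg Prod.fst hz) e
    simp only [boundaryMap, LinearMap.coe_mk, AddHom.coe_mk, Pi.zero_apply] at h
    simp only [Real.cosh_zero, Real.sinh_zero, hS0]
    linarith
  tgt_eq e := by
    have h := congrFun (congrArg (fun y => y.2.1) hz) e
    simp only [boundaryMap, LinearMap.coe_mk, AddHom.coe_mk] at h
    linarith
  deriv e x _ := ((((Real.hasDerivAt_cosh x).const_mul _).add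
    ((Real.hasDerivAt_sinh x).const_mul _)).sub (hS e x)).hasDerivWithinAt
  deriv₂ e x _ := ((((Real.hasDerivAt_sinh x).const_mul (z.1 e)).add
    ((Real.hasDerivAt_cosh x).const_mul (z.2.1 e))).sub (hS' e x)).hasDerivWithinAt.congr_deriv (by
      ring)
  dirichlet v hv := by
    have h := congrFun (congrArg (fun y => y.2.2) hz) v
    simpa [boundaryMap, hv] using h
  neumann v hv := by
    have h := congrFun (congrArg (fun y => y.2.2) hz) v
    simp only [boundaryMap, LinearMap.coe_mk, AddHom.coe_mk, if_neg hv,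
      Finset.sum_neg_distrib] at h
    simp only [Real.cosh_zero, Real.sinh_zero, hS'0, mul_zero, mul_one, zero_add, sub_zero,
      Finset.sum_neg_distrib, Finset.sum_sub_distrib] at h ⊢
    linarith

/-- A kernel element is a solution of the homogeneous equation, hence zero. Its coefficients vanish
because `sinh (length e) ≠ 0`, and its vertex values because every vertex is the end of an edge. -/
theorem boundaryMap_injective [Fintype V] [Nonempty E] (hG : G.Connected) :
    Function.Injective (boundaryMap G D) := by
  rw [← LinearMap.ker_eq_bot, Submodule.eq_bot_iff]
  intro z hz
  have h1 : G.Solves D 0 _ _ z.2.2 := solves_of_boundaryMap_eq (G := G) (D := D) (z := z)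
    (f := 0) (S := 0) (S' := 0) (fun _ => rfl) (fun _ => rfl)
    (fun e x => by simp)
    (fun e x => by simp) (by
      rw [LinearMap.mem_ker.mp hz]
      refine Prod.ext rfl (Prod.ext rfl (funext fun v => ?_))
      simp)
  have h2 := h1.eq_zero
  have ha : ∀ e, z.1 e = 0 := fun e => by
    simpa using h2 e 0 ⟨le_rfl, (G.length_pos e).le⟩
  have hb : ∀ e, z.2.1 e = 0 := fun e => by
    have h3 := h2 e (G.length e) ⟨(G.length_pos e).le, le_rfl⟩
    have h4 : Real.sinh (G.length e) ≠ 0 := (Real.sinh_pos_iff.mpr (G.length_pos e)).ne'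
    simpa [ha e, h4] using h3
  refine Prod.ext (funext ha) (Prod.ext (funext hb) (funext fun v => ?_))
  obtain ⟨e, he | he⟩ := hG.exists_incident v
  · have := h1.src_eq e
    rw [h2 e 0 ⟨le_rfl, (G.length_pos e).le⟩, he] at this
    exact this.symm
  · have := h1.tgt_eq e
    rw [h2 e _ ⟨(G.length_pos e).le, le_rfl⟩, he] at this
    exact this.symm

/-- On each edge the solution is `a cosh + b sinh` minus a particular solution. The boundary and
vertex conditions form a square linear system, so uniqueness implies existence. -/
theorem exists_solves [Fintype V] [Nonempty E] (hG : G.Connected) (D : Finset V)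
    (hf : ∀ e, Continuous (f e)) : ∃ u g φ, G.Solves D f u g φ := by
  choose S S' hS0 hS'0 hS hS' using fun e => exists_particular_solution (hf e)
  obtain ⟨z, hz⟩ := LinearMap.injective_iff_surjective.mp (boundaryMap_injective (D := D) hG)
    (0, fun e => S e (G.length e),
      fun v => if v ∈ D then 0 else ∑ e with G.tgt e = v, -S' e (G.length e))
  exact ⟨_, _, _, solves_of_boundaryMap_eq hS0 hS'0 hS hS' hz⟩

end MetricGraph

end

section

open Set MeasureTheory

/-! ### Continuous functions on a metric graph with the `L²` inner product -/

namespace MetricGraph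

open scoped InnerProductSpace

variable {V E : Type*}

/-- The families of continuous functions on the edges. -/
def GraphFun (G : MetricGraph V E) : Type _ := (e : E) → C(Icc (0 : ℝ) (G.length e), ℝ)

namespace GraphFun

variable {G : MetricGraph V E}

/-- Only the algebraic structure is taken over from the product: the norm is to be the `L²` norm and
not the supremum norm. -/
noncomputable instance : AddCommGroup (GraphFun G) :=
  inferInstanceAs (AddCommGroup ((e : E) → C(Icc (0 : ℝ) (G.length e), ℝ)))

noncomputable instance : Module ℝ (GraphFun G) :=
  inferInstanceAs (Module ℝ ((e : E) → C(Icc (0 : ℝ) (G.length e), ℝ)))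

/-- The restriction of a function to the edge `e`, continued by constants to the real line. -/
noncomputable def ext (x : GraphFun G) (e : E) : ℝ → ℝ :=
  IccExtend (G.length_pos e).le (show C(Icc (0 : ℝ) (G.length e), ℝ) from x e)

theorem continuous_ext (x : GraphFun G) (e : E) : Continuous (x.ext e) :=
  (ContinuousMap.continuous _).Icc_extend'

theorem ext_add (x y : GraphFun G) : (x + y).ext = x.ext + y.ext := rfl

theorem ext_smul (c : ℝ) (x : GraphFun G) : (c • x).ext = c • x.ext := rfl

theorem eq_of_ext {x y : GraphFun G} (h : ∀ e, ∀ t ∈ Icc 0 (G.length e), x.ext e t = y.ext e t) :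
    x = y := by
  refine funext fun e => ContinuousMap.ext fun t => ?_
  have := h e t t.2
  simpa [ext] using this

/-- The continuous function with given restrictions to the edges. -/
noncomputable def mk (u : E → ℝ → ℝ) (hu : ∀ e, ContinuousOn (u e) (Icc 0 (G.length e))) :
    GraphFun G :=
  fun e => ⟨fun t => u e t, (hu e).domRestrict⟩

theorem ext_mk {u : E → ℝ → ℝ} (hu : ∀ e, ContinuousOn (u e) (Icc 0 (G.length e))) :
    ∀ e, ∀ t ∈ Icc 0 (G.length e), (mk u hu).ext e t = u e t := fun e t ht => by
  simp only [ext, mk, IccExtend_of_mem _ _ ht]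
  rfl

variable [Fintype E]

/-- The `L²` inner product. -/
@[reducible] noncomputable def innerCore (G : MetricGraph V E) : InnerProductSpace.Core ℝ (GraphFun G) where
  inner x y := ∑ e, ∫ t in (0 : ℝ)..G.length e, x.ext e t * y.ext e t
  conj_inner_symm x y := by simp [mul_comm]
  re_inner_nonneg x := Finset.sum_nonneg fun e _ =>
    intervalIntegral.integral_nonneg (G.length_pos e).le fun t _ => mul_self_nonneg _
  add_left x y z := by
    rw [← Finset.sum_add_distrib]
    refine Finset.sum_congr rfl fun e _ => ?_
    rw [← intervalIntegral.integral_add]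
    · simp only [ext_add, Pi.add_apply, add_mul]
    · exact ((x.continuous_ext e).mul (z.continuous_ext e)).intervalIntegrable _ _
    · exact ((y.continuous_ext e).mul (z.continuous_ext e)).intervalIntegrable _ _
  smul_left x y r := by
    simp [ext_smul, mul_assoc, Finset.mul_sum]
  definite x hx := by
    refine eq_of_ext fun e t ht => ?_
    have h1 := (Finset.sum_eq_zero_iff_of_nonneg fun e _ =>
      intervalIntegral.integral_nonneg (G.length_pos e).le
        fun t _ => mul_self_nonneg (x.ext e t)).mp hx e (Finset.mem_univ e)
    by_contra h0
    have h2 := intervalIntegral.integral_pos (f := fun t => x.ext e t * x.ext e t)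
      (G.length_pos e) ((x.continuous_ext e).mul (x.continuous_ext e)).continuousOn
      (fun t _ => mul_self_nonneg _) ⟨t, ht, mul_self_pos.mpr h0⟩
    exact h2.ne' h1

noncomputable instance : NormedAddCommGroup (GraphFun G) := (innerCore G).toNormedAddCommGroup

noncomputable instance : InnerProductSpace ℝ (GraphFun G) :=
  InnerProductSpace.ofCore (innerCore G).toCore

theorem inner_def (x y : GraphFun G) :
    ⟪x, y⟫_ℝ = ∑ e, ∫ t in (0 : ℝ)..G.length e, x.ext e t * y.ext e t := rfl

end GraphFun

end MetricGraph

/-! ### Bounds on an interval -/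

/-- Cauchy–Schwarz against the constant `1`, in the form that the variance of `g` is nonnegative. -/
theorem sq_intervalIntegral_le {a b : ℝ} (hab : a ≤ b) {g : ℝ → ℝ}
    (hg : ContinuousOn g (Icc a b)) :
    (∫ x in a..b, g x) ^ 2 ≤ (b - a) * ∫ x in a..b, g x * g x := by
  rcases hab.eq_or_lt with rfl | hlt
  · simp
  have hd : 0 < b - a := by linarith
  rw [← uIcc_of_le hab] at hg
  set m := ∫ x in a..b, g x with hm
  have h1 : 0 ≤ ∫ x in a..b, (g x - m / (b - a)) * (g x - m / (b - a)) :=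
    intervalIntegral.integral_nonneg hab fun x _ => mul_self_nonneg _
  have h2 : ∫ x in a..b, (g x - m / (b - a)) * (g x - m / (b - a)) =
      (∫ x in a..b, g x * g x) - m ^ 2 / (b - a) := by
    have h3 : ∀ x, (g x - m / (b - a)) * (g x - m / (b - a)) =
        g x * g x - 2 * (m / (b - a)) * g x + (m / (b - a)) ^ 2 := fun x => by ring
    simp only [h3]
    rw [intervalIntegral.integral_add, intervalIntegral.integral_sub,
      intervalIntegral.integral_const_mul, intervalIntegral.integral_const, ← hm, smul_eq_mul]
    · field_simp
      ring
    · exact (hg.mul hg).intervalIntegrable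
    · exact (hg.intervalIntegrable).const_mul _
    · exact ((hg.mul hg).intervalIntegrable).sub ((hg.intervalIntegrable).const_mul _)
    · exact intervalIntegrable_const
  rw [h2, sub_nonneg, div_le_iff₀ hd] at h1
  linarith

theorem sq_sub_le_of_integral_le {ℓ : ℝ} {u g : ℝ → ℝ}
    (hu : ∀ x ∈ Icc 0 ℓ, HasDerivWithinAt u (g x) (Icc 0 ℓ) x) (hg : ContinuousOn g (Icc 0 ℓ))
    (h1 : ∫ x in (0 : ℝ)..ℓ, g x * g x ≤ 1) {s t : ℝ} (hs : s ∈ Icc 0 ℓ) (ht : t ∈ Icc 0 ℓ) :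
    (u t - u s) ^ 2 ≤ |t - s| := by
  wlog hst : s ≤ t generalizing s t
  · have := this ht hs (le_of_not_ge hst)
    rw [abs_sub_comm]
    linarith [show (u t - u s) ^ 2 = (u s - u t) ^ 2 by ring]
  have hsub : Icc s t ⊆ Icc 0 ℓ := Icc_subset_Icc hs.1 ht.2
  have hgg : IntervalIntegrable (fun x => g x * g x) volume 0 ℓ := by
    refine ContinuousOn.intervalIntegrable ?_
    rw [uIcc_of_le (hs.1.trans hs.2)]
    exact hg.mul hg
  have h2 : ∫ x in s..t, g x = u t - u s := by
    refine intervalIntegral.integral_eq_sub_of_hasDerivAt_of_le hst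
      (fun x hx => ((hu x (hsub hx)).continuousWithinAt).mono hsub) (fun x hx => ?_) ?_
    · exact (hu x (hsub (Ioo_subset_Icc_self hx))).hasDerivAt
        (Icc_mem_nhds (hs.1.trans_lt hx.1) (hx.2.trans_le ht.2))
    · refine ContinuousOn.intervalIntegrable ?_
      rw [uIcc_of_le hst]
      exact hg.mono hsub
  have h3 := sq_intervalIntegral_le hst (hg.mono hsub)
  have h4 : ∫ x in s..t, g x * g x ≤ ∫ x in (0 : ℝ)..ℓ, g x * g x :=
    intervalIntegral.integral_mono_interval hs.1 hst ht.2
      (Filter.Eventually.of_forall fun x => mul_self_nonneg _) hgg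
  rw [h2] at h3
  rw [abs_of_nonneg (by linarith)]
  refine h3.trans ?_
  nlinarith

theorem sq_le_of_integral_le {ℓ : ℝ} (hℓ : 0 < ℓ) {u g : ℝ → ℝ}
    (hu : ∀ x ∈ Icc 0 ℓ, HasDerivWithinAt u (g x) (Icc 0 ℓ) x) (hg : ContinuousOn g (Icc 0 ℓ))
    (h1 : ∫ x in (0 : ℝ)..ℓ, g x * g x ≤ 1) (h2 : ∫ x in (0 : ℝ)..ℓ, u x * u x ≤ 1) {t : ℝ}
    (ht : t ∈ Icc 0 ℓ) : u t ^ 2 ≤ 2 / ℓ + 2 * ℓ := by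
  have huc : ContinuousOn u (uIcc 0 ℓ) := by
    rw [uIcc_of_le hℓ.le]
    exact fun x hx => (hu x hx).continuousWithinAt
  have huu : IntervalIntegrable (fun x => u x * u x) volume 0 ℓ := (huc.mul huc).intervalIntegrable
  -- The inequality `u(t)² ≤ 2 u(x)² + 2 (u(t) - u(x))²` is averaged over `x`, with `(u(t) - u(x))²
  -- ≤ ℓ`.
  have h3 : ∫ x in (0 : ℝ)..ℓ, u t ^ 2 ≤ ∫ x in (0 : ℝ)..ℓ, (2 * (u x * u x) + 2 * ℓ) := by
    refine intervalIntegral.integral_mono_on hℓ.le intervalIntegrable_const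
      ((huu.const_mul 2).add intervalIntegrable_const) fun x hx => ?_
    have h4 := sq_sub_le_of_integral_le hu hg h1 hx ht
    have h5 : |t - x| ≤ ℓ := abs_le.mpr ⟨by linarith [ht.1, hx.2], by linarith [ht.2, hx.1]⟩
    nlinarith [sq_nonneg (u t - 2 * u x)]
  rw [intervalIntegral.integral_add (huu.const_mul 2) intervalIntegrable_const,
    intervalIntegral.integral_const_mul, intervalIntegral.integral_const,
    intervalIntegral.integral_const, smul_eq_mul, smul_eq_mul, sub_zero] at h3
  have h6 : 2 / ℓ + 2 * ℓ = (2 + ℓ * (2 * ℓ)) / ℓ := by field_simp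
  rw [h6, le_div_iff₀ hℓ]
  linarith

/-- Uniformly bounded functions with a common modulus of continuity form a compact set. -/
theorem isCompact_setOf_holder (ℓ C : ℝ) :
    IsCompact {h : C(Icc (0 : ℝ) ℓ, ℝ) | (∀ t, |h t| ≤ C) ∧
      ∀ s t : Icc (0 : ℝ) ℓ, |h t - h s| ≤ √(dist t s)} := by
  have hsqrt : Filter.Tendsto Real.sqrt (nhds 0) (nhds 0) := by
    have := Real.continuous_sqrt.tendsto 0
    rwa [Real.sqrt_zero] at this
  refine ArzelaAscoli.isCompact_of_equicontinuous _ ?_ ?_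
  · have himage : ContinuousMap.toFun '' {h : C(Icc (0 : ℝ) ℓ, ℝ) | (∀ t, |h t| ≤ C) ∧
        ∀ s t : Icc (0 : ℝ) ℓ, |h t - h s| ≤ √(dist t s)} =
        {h : Icc (0 : ℝ) ℓ → ℝ | (∀ t, |h t| ≤ C) ∧
          ∀ s t : Icc (0 : ℝ) ℓ, |h t - h s| ≤ √(dist t s)} := by
      ext h
      constructor
      · rintro ⟨k, hk, rfl⟩
        exact hk
      · rintro hh
        refine ⟨⟨h, ?_⟩, hh, rfl⟩
        have h1 : Equicontinuous (fun _ : Unit => h) :=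
          Metric.equicontinuous_of_continuity_modulus Real.sqrt hsqrt _ fun x y _ => by
            rw [Real.dist_eq]
            simpa [dist_comm] using hh.2 y x
        exact h1.continuous ()
    rw [himage]
    refine (isCompact_univ_pi fun _ : Icc (0 : ℝ) ℓ =>
      (isCompact_Icc : IsCompact (Icc (-C) C))).of_isClosed_subset ?_ ?_
    · simp only [Set.ofPred_and, Set.ofPred_forall]
      refine IsClosed.inter (isClosed_iInter fun t => ?_)
        (isClosed_iInter fun s => isClosed_iInter fun t => ?_)
      · exact isClosed_le (continuous_apply t).abs continuous_const
      · exact isClosed_le ((continuous_apply t).sub (continuous_apply s)).abs continuous_const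
    · intro h hh t _
      exact abs_le.mp (hh.1 t)
  · refine Metric.equicontinuous_of_continuity_modulus Real.sqrt hsqrt _ fun x y h => ?_
    rw [Real.dist_eq]
    exact h.2.2 y x

namespace MetricGraph

open scoped InnerProductSpace

variable {V E : Type*} {G : MetricGraph V E} [Fintype E]

/-- A set of functions that is compact for uniform convergence is compact in `GraphFun G`. -/
theorem GraphFun.isCompact_pi (A : (e : E) → Set C(Icc (0 : ℝ) (G.length e), ℝ))
    (hA : ∀ e, IsCompact (A e)) : IsCompact {x : GraphFun G | ∀ e, x e ∈ A e} := by
  let ι : ((e : E) → C(Icc (0 : ℝ) (G.length e), ℝ)) →ₗ[ℝ] GraphFun G :=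
    { toFun := fun x => x, map_add' := fun _ _ => rfl, map_smul' := fun _ _ => rfl }
  -- The map `ι` is the identity from the supremum norm to the `L²` norm, bounded by the square root
  -- of the total length.
  have hcont : Continuous ι := by
    refine AddMonoidHomClass.continuous_of_bound ι (√(∑ e, G.length e)) fun x => ?_
    refine le_of_sq_le_sq ?_ (by positivity)
    rw [mul_pow, Real.sq_sqrt (Finset.sum_nonneg fun e _ => (G.length_pos e).le),
      ← real_inner_self_eq_norm_sq, GraphFun.inner_def, Finset.sum_mul]
    refine Finset.sum_le_sum fun e _ => ?_
    have h1 : ∫ t in (0 : ℝ)..G.length e, (ι x).ext e t * (ι x).ext e t ≤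
        ∫ t in (0 : ℝ)..G.length e, ‖x‖ ^ 2 := by
      refine intervalIntegral.integral_mono_on (G.length_pos e).le
        (((ι x).continuous_ext e).mul ((ι x).continuous_ext e) |>.intervalIntegrable _ _)
        intervalIntegrable_const fun t _ => ?_
      have h2 : ‖(ι x).ext e t‖ ≤ ‖x‖ :=
        ((x e).norm_coe_le_norm _).trans (norm_le_pi_norm x e)
      rw [← pow_two, ← sq_abs, ← Real.norm_eq_abs]
      exact pow_le_pow_left₀ (norm_nonneg _) h2 2
    simpa using h1
  have h1 := (isCompact_univ_pi hA).image hcont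
  convert h1 using 1
  ext x
  constructor
  · intro hx
    exact ⟨x, fun e _ => hx e, rfl⟩
  · rintro ⟨y, hy, rfl⟩ e
    exact hy e (mem_univ e)

end MetricGraph

end

section

open Set MeasureTheory

namespace MetricGraph

open scoped InnerProductSpace

/-! ### Solutions of the eigenvalue problem as continuous functions -/

theorem sum_integral_sq_nonneg {V E : Type*} [Fintype E] {G : MetricGraph V E} (g : E → ℝ → ℝ) :
    0 ≤ ∑ e, ∫ t in (0 : ℝ)..G.length e, g e t * g e t :=
  Finset.sum_nonneg fun e _ =>
    intervalIntegral.integral_nonneg (G.length_pos e).le fun _ _ => mul_self_nonneg _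

section Eigenspace

variable {V E : Type*} [DecidableEq V] [Fintype E] {G : MetricGraph V E} (D : Finset V)

/-- Adding `f` to both sides, `-f'' = μ f` becomes `-f'' + f = (1 + μ) f`, the equation inverted by
the Green operator. -/
theorem isSolution_iff {μ : ℝ} {f : E → ℝ → ℝ} : G.IsSolution D μ f ↔
    (∀ e, ∀ x, x ∉ Icc 0 (G.length e) → f e x = 0) ∧ ∃ g φ, G.Solves D ((1 + μ) • f) f g φ := by
  have hder : ∀ e x, -(μ * f e x) = f e x - ((1 + μ) • f) e x := fun e x => by
    simp only [Pi.smul_apply, smul_eq_mul]; ring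
  constructor
  · rintro ⟨h0, φ, g, h1, h2, h3, h4⟩
    exact ⟨h0, g, φ, fun e => (h1 e).1, fun e => (h1 e).2, fun e x hx => (h2 e x hx).1,
      fun e x hx => hder e x ▸ (h2 e x hx).2, h3, h4⟩
  · rintro ⟨h0, g, φ, h⟩
    exact ⟨h0, φ, g, fun e => ⟨h.src_eq e, h.tgt_eq e⟩, fun e x hx =>
      ⟨h.deriv e x hx, (hder e x).symm ▸ h.deriv₂ e x hx⟩, h.dirichlet, h.neumann⟩

theorem continuousOn_of_mem_eigenspace {μ : ℝ} (f : G.eigenspace D μ) (e : E) :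
    ContinuousOn ((f : E → ℝ → ℝ) e) (Icc 0 (G.length e)) := by
  obtain ⟨-, g, φ, h⟩ := isSolution_iff D |>.mp f.2
  exact (h.isTest e).cont

/-- The solutions of the eigenvalue problem as continuous functions on the edges. -/
noncomputable def eigenspaceToGraphFun (μ : ℝ) : G.eigenspace D μ →ₗ[ℝ] GraphFun G where
  toFun f := GraphFun.mk f (continuousOn_of_mem_eigenspace D f)
  map_add' _ _ := rfl
  map_smul' _ _ := rfl

theorem eigenspaceToGraphFun_injective (μ : ℝ) :
    Function.Injective (eigenspaceToGraphFun (G := G) D μ) := fun f f' hff => by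
  refine Subtype.ext (funext fun e => funext fun x => ?_)
  by_cases hx : x ∈ Icc 0 (G.length e)
  · rw [← GraphFun.ext_mk (continuousOn_of_mem_eigenspace D f) e x hx,
      ← GraphFun.ext_mk (continuousOn_of_mem_eigenspace D f') e x hx]
    exact congrFun (congrFun (congrArg GraphFun.ext hff) e) x
  · rw [(isSolution_iff D |>.mp f.2).1 e x hx, (isSolution_iff D |>.mp f'.2).1 e x hx]

end Eigenspace

/-! ### The Green operator and the spectrum -/

section Green

variable {V E : Type*} [Fintype V] [DecidableEq V] [Fintype E] [Nonempty E] {G : MetricGraph V E}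

theorem exists_solves_ext (hG : G.Connected) (D : Finset V) (x : GraphFun G) :
    ∃ (y : GraphFun G) (g : E → ℝ → ℝ) (φ : V → ℝ), G.Solves D x.ext y.ext g φ := by
  obtain ⟨u, g, φ, h⟩ := exists_solves hG D x.continuous_ext
  exact ⟨GraphFun.mk u fun e => (h.isTest e).cont, g, φ,
    h.congr (fun _ _ _ => rfl) (GraphFun.ext_mk _)⟩

/-- The operator that maps `f` to the solution of `-u'' + u = f`. -/
noncomputable def green (hG : G.Connected) (D : Finset V) : GraphFun G →ₗ[ℝ] GraphFun G where
  toFun x := (exists_solves_ext hG D x).choose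
  map_add' x y := by
    obtain ⟨g, φ, h⟩ := (exists_solves_ext hG D x).choose_spec
    obtain ⟨g', φ', h'⟩ := (exists_solves_ext hG D y).choose_spec
    obtain ⟨g'', φ'', h''⟩ := (exists_solves_ext hG D (x + y)).choose_spec
    exact GraphFun.eq_of_ext (h''.unique (h.add h'))
  map_smul' c x := by
    obtain ⟨g, φ, h⟩ := (exists_solves_ext hG D x).choose_spec
    obtain ⟨g', φ', h'⟩ := (exists_solves_ext hG D (c • x)).choose_spec
    exact GraphFun.eq_of_ext (h'.unique (h.smul c))

variable (hG : G.Connected) (D : Finset V)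

theorem green_spec (x : GraphFun G) : ∃ (g : E → ℝ → ℝ) (φ : V → ℝ),
    G.Solves D x.ext (green hG D x).ext g φ :=
  (exists_solves_ext hG D x).choose_spec

theorem green_eq_of_solves {x y : GraphFun G} {g : E → ℝ → ℝ} {φ : V → ℝ}
    (h : G.Solves D x.ext y.ext g φ) : green hG D x = y := by
  obtain ⟨g', φ', h'⟩ := green_spec hG D x
  exact GraphFun.eq_of_ext (h'.unique h)

theorem inner_green (x : GraphFun G) {w : GraphFun G} {w' g : E → ℝ → ℝ} {φ ψ : V → ℝ}
    (h : G.Solves D x.ext (green hG D x).ext g φ)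
    (hw : ∀ e, IsTest (G.length e) (w.ext e) (w' e)) (hsrc : ∀ e, w.ext e 0 = ψ (G.src e))
    (htgt : ∀ e, w.ext e (G.length e) = ψ (G.tgt e)) (hψ : ∀ v ∈ D, ψ v = 0) :
    (∑ e, ∫ t in (0 : ℝ)..G.length e, g e t * w' e t) + ⟪green hG D x, w⟫_ℝ = ⟪x, w⟫_ℝ := by
  have h1 := h.energy (fun e => (x.continuous_ext e).continuousOn) hw hsrc htgt hψ
  rw [Finset.sum_add_distrib] at h1
  exact h1

theorem green_isSymmetric : (green hG D).IsSymmetric := fun x y => by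
  obtain ⟨g, φ, h⟩ := green_spec hG D x
  obtain ⟨g', φ', h'⟩ := green_spec hG D y
  have h1 := inner_green hG D x h h'.isTest h'.src_eq h'.tgt_eq h'.dirichlet
  have h2 := inner_green hG D y h' h.isTest h.src_eq h.tgt_eq h.dirichlet
  have h3 : ∑ e, ∫ t in (0 : ℝ)..G.length e, g e t * g' e t =
      ∑ e, ∫ t in (0 : ℝ)..G.length e, g' e t * g e t := by simp only [mul_comm]
  rw [real_inner_comm y, ← h2, ← h1, h3, real_inner_comm (green hG D y)]

theorem inner_green_self {x : GraphFun G} {g : E → ℝ → ℝ} {φ : V → ℝ}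
    (h : G.Solves D x.ext (green hG D x).ext g φ) :
    (∑ e, ∫ t in (0 : ℝ)..G.length e, g e t * g e t) + ‖green hG D x‖ ^ 2 =
      ⟪green hG D x, x⟫_ℝ := by
  rw [real_inner_comm, ← inner_green hG D x h h.isTest h.src_eq h.tgt_eq h.dirichlet,
    real_inner_self_eq_norm_sq]

theorem green_nonneg (x : GraphFun G) : 0 ≤ ⟪green hG D x, x⟫_ℝ := by
  obtain ⟨g, φ, h⟩ := green_spec hG D x
  rw [← inner_green_self hG D h]
  have := sum_integral_sq_nonneg (G := G) g
  positivity

/-- For `‖x‖ ≤ 1` the energy identity bounds both `∫ (u')²` and `∫ u²` by `1`. This gives a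
Hölder-1/2 modulus and a uniform bound on each edge, and Arzelà–Ascoli applies. -/
theorem exists_isCompact_green : ∃ K : Set (GraphFun G), IsCompact K ∧
    ∀ x, ‖x‖ ≤ 1 → green hG D x ∈ K := by
  refine ⟨_, GraphFun.isCompact_pi _ fun e => isCompact_setOf_holder (G.length e)
    (√(2 / G.length e + 2 * G.length e)), fun x hx e => ?_⟩
  obtain ⟨g, φ, h⟩ := green_spec hG D x
  have h1 := inner_green_self hG D h
  have h2 := real_inner_le_norm (green hG D x) x
  have h3 := sum_integral_sq_nonneg (G := G) g
  have hn := norm_nonneg (green hG D x)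
  have h4 : ‖green hG D x‖ ≤ 1 := by nlinarith [norm_nonneg x]
  have hge : ∫ t in (0 : ℝ)..G.length e, g e t * g e t ≤ 1 := by
    refine (Finset.single_le_sum (f := fun e => ∫ t in (0 : ℝ)..G.length e, g e t * g e t)
      (fun e _ => intervalIntegral.integral_nonneg (G.length_pos e).le
        fun _ _ => mul_self_nonneg _) (Finset.mem_univ e)).trans ?_
    nlinarith [norm_nonneg x]
  have hue : ∫ t in (0 : ℝ)..G.length e, (green hG D x).ext e t * (green hG D x).ext e t ≤ 1 := by
    refine (Finset.single_le_sum (f := fun e => ∫ t in (0 : ℝ)..G.length e,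
        (green hG D x).ext e t * (green hG D x).ext e t)
      (fun e _ => intervalIntegral.integral_nonneg (G.length_pos e).le
        fun _ _ => mul_self_nonneg _) (Finset.mem_univ e)).trans ?_
    rw [← GraphFun.inner_def, real_inner_self_eq_norm_sq]
    nlinarith
  have hgc : ContinuousOn (g e) (Icc 0 (G.length e)) :=
    fun t ht => (h.deriv₂ e t ht).continuousWithinAt
  have hval : ∀ t : Icc (0 : ℝ) (G.length e), (green hG D x) e t = (green hG D x).ext e t :=
    fun t => by simp [GraphFun.ext]
  refine ⟨fun t => ?_, fun s t => ?_⟩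
  · rw [hval]
    exact Real.abs_le_sqrt (sq_le_of_integral_le (G.length_pos e) (h.deriv e) hgc hge hue t.2)
  · rw [hval, hval]
    exact Real.abs_le_sqrt (sq_sub_le_of_integral_le (h.deriv e) hgc hge s.2 t.2)

/-- The Green operator has large Rayleigh quotients on test functions with small energy. -/
theorem norm_sq_le_inner_green {k : ℝ} {w : GraphFun G} {w' : E → ℝ → ℝ} {ψ : V → ℝ}
    (hw : ∀ e, IsTest (G.length e) (w.ext e) (w' e)) (hsrc : ∀ e, w.ext e 0 = ψ (G.src e))
    (htgt : ∀ e, w.ext e (G.length e) = ψ (G.tgt e)) (hψ : ∀ v ∈ D, ψ v = 0)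
    (hform : ∑ e, edgeForm k (G.length e) (w.ext e) (w' e) ≤ 0) :
    (1 + k ^ 2)⁻¹ * ‖w‖ ^ 2 ≤ ⟪green hG D w, w⟫_ℝ := by
  obtain ⟨g, φ, h⟩ := green_spec hG D w
  have h1 := inner_green hG D w h hw hsrc htgt hψ
  have h2 := inner_green_self hG D h
  have hiw : ∀ e, IntervalIntegrable (fun t => w' e t * w' e t) volume 0 (G.length e) :=
    fun e => (hw e).intervalIntegrable_mul (G.length_pos e).le (hw e)
  have hig : ∀ e, IntervalIntegrable (fun t => g e t * g e t) volume 0 (G.length e) :=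
    fun e => (h.isTest e).intervalIntegrable_mul (G.length_pos e).le (h.isTest e)
  have higw : ∀ e, IntervalIntegrable (fun t => g e t * w' e t) volume 0 (G.length e) :=
    fun e => (h.isTest e).intervalIntegrable_mul (G.length_pos e).le (hw e)
  set s : ℝ := 1 + k ^ 2 with hs
  have hs0 : 0 < s := by positivity
  -- the energy of the test function
  have h3 : ∑ e, edgeForm k (G.length e) (w.ext e) (w' e) =
      (∑ e, ∫ t in (0 : ℝ)..G.length e, w' e t * w' e t) - k ^ 2 * ‖w‖ ^ 2 := by
    rw [← real_inner_self_eq_norm_sq, GraphFun.inner_def, Finset.mul_sum, ← Finset.sum_sub_distrib]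
    refine Finset.sum_congr rfl fun e _ => ?_
    simp only [edgeForm, pow_two (w' e _), pow_two (w.ext e _)]
    rw [intervalIntegral.integral_sub (hiw e), intervalIntegral.integral_const_mul]
    exact (((w.continuous_ext e).mul (w.continuous_ext e)).intervalIntegrable _ _).const_mul _
  -- Let `a(u, v) = ∫ u' v' + ∫ u v`. Then `a(w - s G w, w - s G w) ≥ 0`, split into its derivative
  -- part here and its `L²` part in `h5`. Since `a(G w, w) = ‖w‖²`, `a(G w, G w) = ⟪G w, w⟫` and
  -- `a(w, w) ≤ s ‖w‖²`, the claim follows.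
  have h4 : 0 ≤ (∑ e, ∫ t in (0 : ℝ)..G.length e, w' e t * w' e t) -
      2 * s * (∑ e, ∫ t in (0 : ℝ)..G.length e, g e t * w' e t) +
      s ^ 2 * ∑ e, ∫ t in (0 : ℝ)..G.length e, g e t * g e t := by
    rw [Finset.mul_sum, Finset.mul_sum, ← Finset.sum_sub_distrib, ← Finset.sum_add_distrib]
    refine Finset.sum_nonneg fun e _ => ?_
    rw [← intervalIntegral.integral_const_mul, ← intervalIntegral.integral_const_mul,
      ← intervalIntegral.integral_sub (hiw e) ((higw e).const_mul _),
      ← intervalIntegral.integral_add ((hiw e).sub ((higw e).const_mul _)) ((hig e).const_mul _)]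
    refine intervalIntegral.integral_nonneg (G.length_pos e).le fun t _ => ?_
    nlinarith [sq_nonneg (w' e t - s * g e t)]
  have h5 : 0 ≤ ‖w - s • green hG D w‖ ^ 2 := by positivity
  rw [norm_sub_sq_real, real_inner_smul_right, norm_smul, Real.norm_of_nonneg hs0.le,
    real_inner_comm] at h5
  rw [real_inner_self_eq_norm_sq] at h1
  rw [inv_mul_le_iff₀ hs0]
  have h6 : 0 ≤ s * (s * ⟪green hG D w, w⟫_ℝ - ‖w‖ ^ 2) := by
    rw [← h2]
    nlinarith
  linarith [nonneg_of_mul_nonneg_right h6 hs0]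

theorem green_eigenspaceToGraphFun {μ : ℝ} (f : G.eigenspace D μ) :
    (1 + μ) • green hG D (eigenspaceToGraphFun D μ f) = eigenspaceToGraphFun D μ f := by
  obtain ⟨-, g, φ, h⟩ := isSolution_iff D |>.mp f.2
  have hext := GraphFun.ext_mk (continuousOn_of_mem_eigenspace D f)
  rw [← map_smul]
  refine green_eq_of_solves hG D (h.congr (fun e x hx => ?_) hext)
  simp only [GraphFun.ext_smul, Pi.smul_apply]
  rw [← hext e x hx]
  rfl

theorem range_eigenspaceToGraphFun {μ : ℝ} (hμ : 0 < 1 + μ) :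
    LinearMap.range (eigenspaceToGraphFun (G := G) D μ) =
      Module.End.eigenspace (green hG D) (1 + μ)⁻¹ := by
  ext x
  rw [Module.End.mem_eigenspace_iff]
  constructor
  · rintro ⟨f, rfl⟩
    conv_rhs => rw [← green_eigenspaceToGraphFun hG D f, smul_smul, inv_mul_cancel₀ hμ.ne', one_smul]
  · intro hx
    obtain ⟨g, φ, h⟩ := green_spec hG D x
    rw [hx] at h
    have h1 := h.smul (1 + μ)
    rw [GraphFun.ext_smul, smul_smul, mul_inv_cancel₀ hμ.ne', one_smul] at h1
    -- Solutions are normalised to vanish off the edges, so the constant continuation is cut off.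
    let f : E → ℝ → ℝ := fun e => (Icc 0 (G.length e)).indicator (x.ext e)
    have hf : ∀ e, ∀ t ∈ Icc 0 (G.length e), f e t = x.ext e t :=
      fun e t ht => indicator_of_mem ht _
    have hmem : f ∈ G.eigenspace D μ := (isSolution_iff D).mpr
      ⟨fun e t ht => indicator_of_notMem ht _, _, _, h1.congr (fun e t ht => by
        simp only [Pi.smul_apply, hf e t ht]) hf⟩
    refine ⟨⟨f, hmem⟩, GraphFun.eq_of_ext fun e t ht => ?_⟩
    rw [← hf e t ht]
    exact GraphFun.ext_mk (continuousOn_of_mem_eigenspace D ⟨f, hmem⟩) e t ht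

theorem eigenspace_eq_bot (hG : G.Connected) (D : Finset V) {μ : ℝ} (hμ : 1 + μ ≤ 0) : G.eigenspace D μ = ⊥ := by
  by_contra hne
  obtain ⟨f, hf, hf0⟩ := Submodule.exists_mem_ne_zero_of_ne_bot hne
  have h1 := green_eigenspaceToGraphFun hG D ⟨f, hf⟩
  set x := eigenspaceToGraphFun D μ ⟨f, hf⟩ with hx
  have hx0 : x ≠ 0 := fun h => hf0 (by
    have := eigenspaceToGraphFun_injective D μ (h.trans (map_zero _).symm)
    exact congrArg Subtype.val this)
  have h2 : ‖x‖ ^ 2 = (1 + μ) * ⟪green hG D x, x⟫_ℝ := by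
    rw [← real_inner_smul_left, h1, real_inner_self_eq_norm_sq]
  have h3 := green_nonneg hG D x
  have h4 : 0 < ‖x‖ := norm_pos_iff.mpr hx0
  nlinarith [pow_pos h4 2]

theorem finrank_eigenspace {μ : ℝ} (hμ : 0 < 1 + μ) :
    Module.finrank ℝ (G.eigenspace D μ) =
      Module.finrank ℝ (Module.End.eigenspace (green hG D) (1 + μ)⁻¹) := by
  rw [← range_eigenspaceToGraphFun hG D hμ,
    LinearMap.finrank_range_of_inj (eigenspaceToGraphFun_injective D μ)]

theorem finiteDimensional_eigenspace (hG : G.Connected) (D : Finset V) (μ : ℝ) : FiniteDimensional ℝ (G.eigenspace D μ) := by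
  rcases le_or_gt (1 + μ) 0 with hμ | hμ
  · rw [eigenspace_eq_bot hG D hμ]
    infer_instance
  · obtain ⟨K, hK, hKT⟩ := exists_isCompact_green hG D
    have h1 := finiteDimensional_eigenspace_of_isCompact hK hKT (inv_pos.mpr hμ)
    rw [← range_eigenspaceToGraphFun hG D hμ] at h1
    exact Module.Finite.equiv
      (LinearEquiv.ofInjective _ (eigenspaceToGraphFun_injective D μ)).symm

/-! ### Counting eigenvalues with test spaces -/

theorem multiplicity_eq (hG : G.Connected) (D : Finset V) (μ : ℝ) :
    G.multiplicity D μ = Module.finrank ℝ (G.eigenspace D μ) := by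
  have := finiteDimensional_eigenspace hG D μ
  rw [multiplicity, ← Module.finrank_eq_rank]
  simp

theorem finite_eigenvalues_le (hG : G.Connected) (D : Finset V) (t : ℝ) :
    {μ : ℝ | μ ≤ t ∧ Module.finrank ℝ (G.eigenspace D μ) ≠ 0}.Finite := by
  obtain ⟨K, hK, hKT⟩ := exists_isCompact_green hG D
  have hpos : ∀ μ, Module.finrank ℝ (G.eigenspace D μ) ≠ 0 → 0 < 1 + μ := fun μ hμ => by
    by_contra! h
    rw [eigenspace_eq_bot hG D h] at hμ
    simp at hμ
  rcases le_or_gt (1 + t) 0 with ht | ht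
  · refine Set.finite_empty.subset fun μ hμ => ?_
    have := hpos μ hμ.2
    linarith [hμ.1]
  · have h1 := finite_eigenvalues_ge_of_isCompact (green_isSymmetric hG D) hK hKT
      (inv_pos.mpr ht)
    refine (h1.image fun κ => κ⁻¹ - 1).subset fun μ hμ => ?_
    have hμ0 := hpos μ hμ.2
    refine ⟨(1 + μ)⁻¹, ⟨inv_anti₀ hμ0 (by linarith [hμ.1]), ?_⟩, by simp⟩
    rw [Module.End.hasEigenvalue_iff]
    intro hbot
    have := hμ.2
    rw [finrank_eigenspace hG D hμ0, hbot] at this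
    simp at this

/-- The eigenvalues up to `k²` have total multiplicity at least the dimension of any test space. -/
theorem HasTestSpace.le_sum_finrank (hG : G.Connected) (D : Finset V) {k : ℝ} {N : ℕ}
    (h : HasTestSpace G k Finset.univ (vertexPhase D) N) :
    N ≤ ∑ μ ∈ (finite_eigenvalues_le hG D (k ^ 2)).toFinset,
      Module.finrank ℝ (G.eigenspace D μ) := by
  classical
  obtain ⟨ι, _, rfl, ⟨T⟩⟩ := h
  obtain ⟨K, hK, hKT⟩ := exists_isCompact_green hG D
  have hk : 0 < (1 + k ^ 2)⁻¹ := by positivity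
  have hwc : ∀ c e, ContinuousOn (T.w c e) (Icc 0 (G.length e)) :=
    fun c e => (T.isTest c e (Finset.mem_univ e)).cont
  let W : (ι → ℝ) →ₗ[ℝ] GraphFun G :=
    { toFun := fun c => GraphFun.mk (T.w c) (hwc c)
      map_add' := fun c d => GraphFun.eq_of_ext fun e t ht => by
        rw [GraphFun.ext_mk _ e t ht, GraphFun.ext_add, Pi.add_apply, Pi.add_apply,
          GraphFun.ext_mk _ e t ht, GraphFun.ext_mk _ e t ht, map_add]
        rfl
      map_smul' := fun r c => GraphFun.eq_of_ext fun e t ht => by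
        rw [GraphFun.ext_mk _ e t ht, RingHom.id_apply, GraphFun.ext_smul, Pi.smul_apply,
          Pi.smul_apply, GraphFun.ext_mk _ e t ht, map_smul]
        rfl }
  have hWext : ∀ c e, ∀ t ∈ Icc 0 (G.length e), (W c).ext e t = T.w c e t :=
    fun c => GraphFun.ext_mk (hwc c)
  have h0 : ∀ e, (0 : ℝ) ∈ Icc 0 (G.length e) := fun e => ⟨le_rfl, (G.length_pos e).le⟩
  have hℓ : ∀ e, G.length e ∈ Icc 0 (G.length e) := fun e => ⟨(G.length_pos e).le, le_rfl⟩
  have hinj : Function.Injective W := by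
    rw [← LinearMap.ker_eq_bot, Submodule.eq_bot_iff]
    intro c hc
    have hz : ∀ e, ∀ t ∈ Icc 0 (G.length e), T.w c e t = 0 := fun e t ht => by
      rw [← hWext c e t ht, LinearMap.mem_ker.mp hc]
      rfl
    refine T.inj c (funext fun v => ?_) fun e _ => hz e
    obtain ⟨e, he | he⟩ := hG.exists_incident v
    · rw [← he, ← T.src_eq c e (Finset.mem_univ e), hz e 0 (h0 e)]; rfl
    · rw [← he, ← T.tgt_eq c e (Finset.mem_univ e), hz e _ (hℓ e)]; rfl
  have hle : ∀ c, (1 + k ^ 2)⁻¹ * ‖W c‖ ^ 2 ≤ ⟪green hG D (W c), W c⟫_ℝ := fun c => by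
    refine norm_sq_le_inner_green hG D (w' := T.g c) (ψ := T.φ c)
      (fun e => (T.isTest c e (Finset.mem_univ e)).congr (hWext c e) (G.length_pos e).le)
      (fun e => by rw [hWext c e 0 (h0 e), T.src_eq c e (Finset.mem_univ e)])
      (fun e => by rw [hWext c e _ (hℓ e), T.tgt_eq c e (Finset.mem_univ e)])
      (fun v hv => T.dirichlet c v (by simp [vertexPhase, hv])) ?_
    have h1 := T.form_nonpos c
    -- The vertex terms drop out: `cot (π / 2) = 0`, and `cot 0` is `0` by convention.
    have h2 : ∑ v, k * Real.cot (vertexPhase D v) * T.φ c v ^ 2 = 0 :=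
      Finset.sum_eq_zero fun v _ => by
        unfold vertexPhase
        split_ifs <;> simp [Real.cot_eq_cos_div_sin]
    rw [h2, add_zero] at h1
    refine le_trans (le_of_eq (Finset.sum_congr rfl fun e _ => ?_)) h1
    refine intervalIntegral.integral_congr fun t ht => ?_
    rw [uIcc_of_le (G.length_pos e).le] at ht
    simp only [hWext c e t ht]
  have hfin := finite_eigenvalues_ge_of_isCompact (green_isSymmetric hG D) hK hKT hk
  refine (card_le_sum_finrank_eigenspace (green_isSymmetric hG D) hK hKT (green_nonneg hG D) hk
    hfin.toFinset (fun κ hκ hκ' => by simpa using ⟨hκ, hκ'⟩)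
    (fun κ hκ => hk.trans_le (by simpa using (hfin.mem_toFinset.mp hκ).1)) W hinj hle).trans ?_
  have hpos : ∀ κ ∈ hfin.toFinset, 0 < κ := fun κ hκ =>
    hk.trans_le (hfin.mem_toFinset.mp hκ).1
  have hrank : ∀ κ ∈ hfin.toFinset, Module.finrank ℝ (Module.End.eigenspace (green hG D) κ) =
      Module.finrank ℝ (G.eigenspace D (κ⁻¹ - 1)) := fun κ hκ => by
    have := inv_pos.mpr (hpos κ hκ)
    rw [finrank_eigenspace hG D (by linarith), add_sub_cancel, inv_inv]
  -- Reindexing by `μ = κ⁻¹ - 1`: the condition `κ ≥ (1 + k²)⁻¹` becomes `μ ≤ k²`.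
  rw [Finset.sum_congr rfl hrank, ← Finset.sum_image (f := fun μ =>
    Module.finrank ℝ (G.eigenspace D μ)) (g := fun κ : ℝ => κ⁻¹ - 1)
    fun a _ b _ hab => inv_injective (by simpa using hab)]
  refine Finset.sum_le_sum_of_ne_zero fun μ hμ hμ0 => ?_
  obtain ⟨κ, hκ, rfl⟩ := Finset.mem_image.mp hμ
  rw [Set.Finite.mem_toFinset]
  refine ⟨?_, hμ0⟩
  have := inv_anti₀ hk (hfin.mem_toFinset.mp hκ).1
  rw [inv_inv] at this
  linarith

/-- A linear lower bound for the dimensions of the test spaces bounds the eigenvalues. -/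
theorem eigenvalue_bounds (hG : G.Connected) (D : Finset V) (s : ℕ) {b : ℝ} (hspace : ∀ k, 0 < k → ∃ N : ℕ,
      HasTestSpace G k Finset.univ (vertexPhase D) N ∧ k * G.totalLength ≤ Real.pi * (N + b)) :
    (∃ lam : ℕ → ℝ, G.IsEigenvalueSequence D s lam) ∧
      ∀ lam : ℕ → ℝ, G.IsEigenvalueSequence D s lam → ∀ n : ℕ, 0 ≤ n + b →
        lam (s + n) ≤ (n + b) ^ 2 * Real.pi ^ 2 / G.totalLength ^ 2 := by
  have hpi := Real.pi_pos
  have hL : 0 < G.totalLength := Finset.sum_pos (fun e _ => G.length_pos e) Finset.univ_nonempty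
  have hlarge : ∀ (n : ℕ) (k : ℝ), 0 < k → (n + b) * Real.pi < k * G.totalLength →
      n < ∑ μ ∈ (finite_eigenvalues_le hG D (k ^ 2)).toFinset,
        Module.finrank ℝ (G.eigenspace D μ) := fun n k hk hlt => by
    obtain ⟨N, hN, hbound⟩ := hspace k hk
    refine lt_of_lt_of_le ?_ (hN.le_sum_finrank hG D)
    have h1 : Real.pi * (n + b) < Real.pi * (N + b) := by linarith
    have h2 := lt_of_mul_lt_mul_left h1 hpi.le
    exact_mod_cast (by linarith : (n : ℝ) < N)
  constructor
  · obtain ⟨lam, h1, h2⟩ := exists_monotone_seq_of_multiplicity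
      (fun μ => Module.finrank ℝ (G.eigenspace D μ)) (finite_eigenvalues_le hG D) (fun n => by
        obtain ⟨k, hk⟩ := exists_gt (max 0 ((n + b) * Real.pi / G.totalLength))
        refine ⟨k ^ 2, (hlarge n k ((le_max_left _ _).trans_lt hk) ?_).le⟩
        exact (div_lt_iff₀ hL).mp ((le_max_right _ _).trans_lt hk)) s
    exact ⟨lam, h1, fun μ => by rw [h2, multiplicity_eq hG]⟩
  · rintro lam ⟨h1, h2⟩ n hn
    simp only [multiplicity_eq hG] at h2
    by_contra! hlt
    set k₀ := (n + b) * Real.pi / G.totalLength with hk₀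
    have hk₀0 : 0 ≤ k₀ := by positivity
    have hk₀sq : (n + b) ^ 2 * Real.pi ^ 2 / G.totalLength ^ 2 = k₀ ^ 2 := by
      rw [hk₀, div_pow, mul_pow]
    rw [hk₀sq] at hlt
    -- At `k₀` itself only `N ≥ n` would follow, whereas `N > n` is needed. Hence some `k = √t`
    -- slightly above `k₀` is used, with `t` still below the supposed eigenvalue.
    obtain ⟨t, ht1, ht2⟩ := exists_between hlt
    have ht0 : 0 ≤ t := (sq_nonneg k₀).trans ht1.le
    have hk : k₀ < √t := Real.lt_sqrt_of_sq_lt ht1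
    have h3 := seq_le_of_lt_sum_multiplicity h1 h2 (t := √t ^ 2)
      (fun μ hμ => ((Set.Finite.mem_toFinset _).mp hμ).1)
      (hlarge n (√t) (hk₀0.trans_lt hk) ((div_lt_iff₀ hL).mp hk))
    rw [Real.sq_sqrt ht0] at h3
    linarith

end Green

end MetricGraph

end

/-! ### The two bounds -/

theorem lemma1p5 {V E : Type*} [Fintype V] [DecidableEq V] [Fintype E] [Nonempty E]
    (G : MetricGraph V E) (hG : G.Connected) :
    -- Dirichlet conditions at `D`: the eigenvalues are indexed from `1`
    (∀ D : Finset V, D.Nonempty → (∀ v, G.IsPendant v → v ∈ D) →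
      (∃ lam : ℕ → ℝ, G.IsEigenvalueSequence D 1 lam) ∧
      ∀ lam : ℕ → ℝ, G.IsEigenvalueSequence D 1 lam → ∀ j : ℕ, 1 ≤ j →
        lam j ≤ ((j : ℝ) - 2 + 2 * (G.betti : ℝ) + (D.card : ℝ)) ^ 2 * Real.pi ^ 2
          / G.totalLength ^ 2) ∧
    -- Neumann conditions everywhere: the eigenvalues are indexed from `0`
    ((∀ v, ¬ G.IsPendant v) →
      (∃ lam : ℕ → ℝ, G.IsEigenvalueSequence ∅ 0 lam) ∧
      ∀ lam : ℕ → ℝ, G.IsEigenvalueSequence ∅ 0 lam → ∀ j : ℕ, 1 ≤ j →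
        lam j ≤ ((j : ℝ) - 1 + 2 * (G.betti : ℝ)) ^ 2 * Real.pi ^ 2 / G.totalLength ^ 2) := by
  have hβ : (0 : ℝ) ≤ G.betti := by exact_mod_cast hG.betti_nonneg
  constructor
  · intro D hD hpend
    -- The list starts at `1`, so `j = 1 + n` and `n + b = j - 2 + 2 * β + |D|`. In the Neumann case
    -- below the list starts at `0` and `n = j`.
    obtain ⟨h1, h2⟩ := MetricGraph.eigenvalue_bounds hG D 1 (b := -1 + 2 * G.betti + D.card)
      fun k hk => by
        obtain ⟨N, hN, hb⟩ := MetricGraph.exists_testSpace_of_nonempty hG hD hpend hk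
        exact ⟨N, hN, hb.trans_eq (by ring)⟩
    refine ⟨h1, fun lam hlam j hj => ?_⟩
    obtain ⟨n, rfl⟩ := Nat.exists_eq_add_of_le hj
    have hcard : (1 : ℝ) ≤ D.card := by exact_mod_cast hD.card_pos
    refine (h2 lam hlam n (by linarith [n.cast_nonneg (α := ℝ)])).trans_eq ?_
    push_cast
    ring_nf
  · intro hpend
    obtain ⟨h1, h2⟩ := MetricGraph.eigenvalue_bounds hG ∅ 0 (b := -1 + 2 * G.betti)
      fun k hk => by
        obtain ⟨N, hN, hb⟩ := MetricGraph.exists_testSpace_of_empty hG hpend hk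
        exact ⟨N, hN, hb.trans_eq (by ring)⟩
    refine ⟨h1, fun lam hlam j hj => ?_⟩
    have hj' : (1 : ℝ) ≤ j := by exact_mod_cast hj
    have h3 := h2 lam hlam j (by linarith)
    rw [zero_add] at h3
    exact h3.trans_eq (by ring_nf)
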